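/- Let $G_{5,3}=\mathbb R^5$ be the simply connected nilpotent Lie group with multiplication $$x\cdot y=\bigl(x_1+y_1+x_4y_3+x_5y_2+\tfrac12x_5^2y_4,\;x_2+y_2+x_5y_4,\;x_3+y_3,\;x_4+y_4,\;x_5+y_5\bigr),$$ whose center is $Z=\mathbb R\times\{(0,0,0,0)\}$. For $\lambda\in\mathbb R\setminus\{0\}$ let $\pi_\lambda$ be its representation (irreducible, unitary, square-integrable modulo the center) on $L^2(\mathbb R^2)$, $$\pi_\lambda(x)g(s,t)=e^{2\pi i\lambda(x_1-x_3x_4+x_4s-x_2t+\frac12x_4t^2)}\,g(s-x_3,t-x_5).$$ It acts on the Schwartz space $\mathcal S(\mathbb R^2)$. Write $\langle f,g\rangle$ for the sesquilinear pairing of $f\in\mathcal S'(\mathbb R^2)$ and $g\in\mathcal S(\mathbb R^2)$ that extends the inner product of $L^2(\mathbb R^2)$. For $1\le p\le\infty$ and a window $g\in\mathcal S(\mathbb R^2)\setminus\{0\}$, the coorbit space is $$Co_{\pi_\lambda}L^p(G_{5,3}/Z)=\bigl\{f\in\mathcal S'(\mathbb R^2):(x_2,x_3,x_4,x_5)\mapsto\langle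 f,\pi_\lambda(0,x_2,x_3,x_4,x_5)g\rangle\in L^p(\mathbb R^4)\bigr\}.$$ A moderate weight on $\mathbb R^4$ is a measurable function $m:\mathbb R^4\to(0,\infty)$ for which there are $C>0$ and $N\in\mathbb N$ with $m(z+w)\le C(1+|z|)^N m(w)$ for all $z,w\in\mathbb R^4$. For such $m$ and a window $\gamma\in\mathcal S(\mathbb R^2)\setminus\{0\}$, the modulation space is $$M^p_m(\mathbb R^2)=\bigl\{f\in\mathcal S'(\mathbb R^2):(x,\xi)\mapsto\langle f,M_\xi T_x\gamma\rangle\,m(x,\xi)\in L^p(\mathbb R^4)\bigr\},\qquad M_\xi T_x\gamma(t)=e^{2\pi i\xi\cdot t}\gamma(t-x).$$ **Theorem.** Let $1\le p\le\infty$ with $p\ne2$, let $\lambda\neq0$, and let $m$ be any moderate weight on $\mathbb R^4$. Then, for every choice of the non-zero windows $g,\gamma\in\mathcal S(\mathbb R^2)$, $$Co_{\pi_\lambda}L^p(G_{5,3}/Z)\neq M^p_m(\mathbb R^2)$$ as subsets of $\mathcal S'(\mathbb R^2)$. -/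

import Mathlib

open MeasureTheory SchwartzMap
open scoped ENNReal

noncomputable section

/-! ### Schwartz functions on the plane, oscillating multipliers, the sesquilinear pairing -/

/-- `x ↦ e^{2π i θ(x)}` has temperate growth if the real phase `θ` has. -/
theorem hasTemperateGrowth_exp_phase {θ : ℝ × ℝ → ℝ} (hθ : θ.HasTemperateGrowth) :
    (fun x => Complex.exp (2 * Real.pi * Complex.I * (θ x : ℂ))).HasTemperateGrowth := by
  have hd : ∀ y : ℝ, HasDerivAt (fun y : ℝ => Complex.exp (2 * Real.pi * Complex.I * (y : ℂ)))
      ((2 * Real.pi * Complex.I) * Complex.exp (2 * Real.pi * Complex.I * (y : ℂ))) y := by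
    intro y
    have h := (((hasDerivAt_id (y : ℂ)).const_mul (2 * Real.pi * Complex.I)).cexp).comp_ofReal
    simpa [mul_comm] using h
  have hn : ∀ n : ℕ, iteratedDeriv n
      (fun y : ℝ => Complex.exp (2 * Real.pi * Complex.I * (y : ℂ))) =
      fun y : ℝ => (2 * Real.pi * Complex.I) ^ n *
        Complex.exp (2 * Real.pi * Complex.I * (y : ℂ)) := by
    intro n
    induction n with
    | zero => simp
    | succ n ih =>
      rw [iteratedDeriv_succ, ih]
      funext y
      rw [((hd y).const_mul _).deriv]
      ring
  have hE : (fun y : ℝ => Complex.exp (2 * Real.pi * Complex.I * (y : ℂ))).HasTemperateGrowth := by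
    refine ⟨?_, fun n => ⟨0, (2 * Real.pi) ^ n, fun y => ?_⟩⟩
    · exact (contDiff_const.mul Complex.ofRealCLM.contDiff).cexp
    · rw [norm_iteratedFDeriv_eq_norm_iteratedDeriv, hn]
      have : ‖Complex.exp (2 * Real.pi * Complex.I * (y : ℂ))‖ = 1 := by
        have := Complex.norm_exp_ofReal_mul_I (2 * Real.pi * y)
        rw [← this]; push_cast; ring_nf
      rw [norm_mul, this]
      simp [abs_of_pos Real.pi_pos]
  exact hE.comp hθ

/-- The operator `f(t) ↦ e^{2π i θ(t)} f(t - a)` on `𝓢(ℝ²)`. -/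
def phaseShift (θ : ℝ × ℝ → ℝ) (a : ℝ × ℝ) : 𝓢(ℝ × ℝ, ℂ) →L[ℂ] 𝓢(ℝ × ℝ, ℂ) :=
  (smulLeftCLM ℂ fun t => Complex.exp (2 * Real.pi * Complex.I * (θ t : ℂ))).comp
    (compSubConstCLM ℂ a)

theorem phaseShift_apply {θ : ℝ × ℝ → ℝ} (hθ : θ.HasTemperateGrowth) (a : ℝ × ℝ)
    (f : 𝓢(ℝ × ℝ, ℂ)) (t : ℝ × ℝ) :
    phaseShift θ a f t = Complex.exp (2 * Real.pi * Complex.I * (θ t : ℂ)) * f (t - a) := by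
  simp [phaseShift, smulLeftCLM_apply_apply (hasTemperateGrowth_exp_phase hθ)]

/-- Complex conjugation of Schwartz functions. -/
def schwartzConj (g : 𝓢(ℝ × ℝ, ℂ)) : 𝓢(ℝ × ℝ, ℂ) :=
  postcompCLM (𝕜 := ℝ) (Complex.conjCLE : ℂ →L[ℝ] ℂ) g

theorem schwartzConj_apply (g : 𝓢(ℝ × ℝ, ℂ)) (t : ℝ × ℝ) :
    schwartzConj g t = (starRingEnd ℂ) (g t) := rfl

/-- The sesquilinear pairing `⟨f, g⟩` of `f ∈ 𝓢'(ℝ²)` and `g ∈ 𝓢(ℝ²)`, which extends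
`∫ f(t) conj (g(t)) dt`. -/
def distPairing (f : 𝓢'(ℝ × ℝ, ℂ)) (g : 𝓢(ℝ × ℝ, ℂ)) : ℂ := f (schwartzConj g)

/-! ### Modulation spaces on the plane -/

/-- The phase `t ↦ ξ · t`. -/
def modPhase (ξ : ℝ × ℝ) (t : ℝ × ℝ) : ℝ := ξ.1 * t.1 + ξ.2 * t.2

/-- The time-frequency shift `M_ξ T_x g (t) = e^{2π i ξ · t} g(t - x)`. -/
def tfShift (x ξ : ℝ × ℝ) : 𝓢(ℝ × ℝ, ℂ) →L[ℂ] 𝓢(ℝ × ℝ, ℂ) := phaseShift (modPhase ξ) x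

theorem hasTemperateGrowth_fst : (fun t : ℝ × ℝ => t.1).HasTemperateGrowth :=
  (ContinuousLinearMap.fst ℝ ℝ ℝ).hasTemperateGrowth

theorem hasTemperateGrowth_snd : (fun t : ℝ × ℝ => t.2).HasTemperateGrowth :=
  (ContinuousLinearMap.snd ℝ ℝ ℝ).hasTemperateGrowth

theorem hasTemperateGrowth_modPhase (ξ : ℝ × ℝ) : (modPhase ξ).HasTemperateGrowth :=
  ((Function.HasTemperateGrowth.const ξ.1).mul hasTemperateGrowth_fst).add
    ((Function.HasTemperateGrowth.const ξ.2).mul hasTemperateGrowth_snd)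

theorem tfShift_apply (x ξ : ℝ × ℝ) (g : 𝓢(ℝ × ℝ, ℂ)) (t : ℝ × ℝ) :
    tfShift x ξ g t =
      Complex.exp (2 * Real.pi * Complex.I * ((ξ.1 * t.1 + ξ.2 * t.2 : ℝ) : ℂ)) * g (t - x) :=
  phaseShift_apply (hasTemperateGrowth_modPhase ξ) x g t

/-- The short-time Fourier transform `S_g f (x, ξ) = ⟨f, M_ξ T_x g⟩`. -/
def stft (g : 𝓢(ℝ × ℝ, ℂ)) (f : 𝓢'(ℝ × ℝ, ℂ)) (z : (ℝ × ℝ) × (ℝ × ℝ)) : ℂ :=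
  distPairing f (tfShift z.1 z.2 g)

/-- A moderate weight on `ℝ⁴`: a positive measurable function with
`m (z + w) ≤ v z * m w` for a function `v` of polynomial growth. -/
structure IsModerateWeight (m : (ℝ × ℝ) × (ℝ × ℝ) → ℝ) : Prop where
  measurable : Measurable m
  pos : ∀ z, 0 < m z
  moderate : ∃ (C : ℝ) (N : ℕ), ∀ z w, m (z + w) ≤ C * (1 + ‖z‖) ^ N * m w

/-- The modulation space `M^p_m(ℝ²)`, with window `g`: the tempered distributions `f` with
`S_g f ∈ L^p_m(ℝ⁴)`. -/
def modulationSpace (p : ℝ≥0∞) (m : (ℝ × ℝ) × (ℝ × ℝ) → ℝ) (g : 𝓢(ℝ × ℝ, ℂ)) :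
    Set 𝓢'(ℝ × ℝ, ℂ) :=
  {f | MemLp (fun z => stft g f z * (m z : ℂ)) p volume}

/-! ### The nilpotent group `G_{5,3}` and its representations `π_λ` -/

/-- The simply connected nilpotent Lie group `G_{5,3}` in its global coordinates. -/
@[ext]
structure G53 where
  x₁ : ℝ
  x₂ : ℝ
  x₃ : ℝ
  x₄ : ℝ
  x₅ : ℝ

namespace G53

instance : Mul G53 where
  mul x y :=
    ⟨x.x₁ + y.x₁ + x.x₄ * y.x₃ + x.x₅ * y.x₂ + 1 / 2 * x.x₅ ^ 2 * y.x₄,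
      x.x₂ + y.x₂ + x.x₅ * y.x₄, x.x₃ + y.x₃, x.x₄ + y.x₄, x.x₅ + y.x₅⟩

instance : One G53 where
  one := ⟨0, 0, 0, 0, 0⟩

instance : Inv G53 where
  inv x :=
    ⟨-x.x₁ + x.x₃ * x.x₄ + x.x₂ * x.x₅ - 1 / 2 * x.x₅ ^ 2 * x.x₄,
      -x.x₂ + x.x₅ * x.x₄, -x.x₃, -x.x₄, -x.x₅⟩

theorem mul_def (x y : G53) : x * y =
    ⟨x.x₁ + y.x₁ + x.x₄ * y.x₃ + x.x₅ * y.x₂ + 1 / 2 * x.x₅ ^ 2 * y.x₄,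
      x.x₂ + y.x₂ + x.x₅ * y.x₄, x.x₃ + y.x₃, x.x₄ + y.x₄, x.x₅ + y.x₅⟩ := rfl

theorem one_def : (1 : G53) = ⟨0, 0, 0, 0, 0⟩ := rfl

theorem inv_def (x : G53) : x⁻¹ =
    ⟨-x.x₁ + x.x₃ * x.x₄ + x.x₂ * x.x₅ - 1 / 2 * x.x₅ ^ 2 * x.x₄,
      -x.x₂ + x.x₅ * x.x₄, -x.x₃, -x.x₄, -x.x₅⟩ := rfl

instance : Group G53 :=
  Group.ofLeftAxioms
    (fun x y z => by ext <;> simp only [mul_def] <;> ring)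
    (fun x => by ext <;> simp only [mul_def, one_def] <;> ring)
    (fun x => by ext <;> simp only [mul_def, one_def, inv_def] <;> ring)

/-- The center of `G_{5,3}` is `ℝ × {(0,0,0,0)}`. -/
theorem mem_center_iff (x : G53) :
    x ∈ Subgroup.center G53 ↔ x.x₂ = 0 ∧ x.x₃ = 0 ∧ x.x₄ = 0 ∧ x.x₅ = 0 := by
  rw [Subgroup.mem_center_iff]
  constructor
  · intro h
    have h2 := congrArg G53.x₁ (h ⟨0, 1, 0, 0, 0⟩)
    have h3 := congrArg G53.x₁ (h ⟨0, 0, 1, 0, 0⟩)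
    have h4 := congrArg G53.x₁ (h ⟨0, 0, 0, 1, 0⟩)
    have h5 := congrArg G53.x₁ (h ⟨0, 0, 0, 0, 1⟩)
    simp only [mul_def] at h2 h3 h4 h5
    have e5 : x.x₅ = 0 := by linarith
    have e4 : x.x₄ = 0 := by linarith
    rw [e5] at h4
    rw [e4] at h5
    exact ⟨by linarith, by linarith, e4, e5⟩
  · rintro ⟨h2, h3, h4, h5⟩ y
    ext <;> simp only [mul_def, h2, h3, h4, h5] <;> ring

/-- The phase of `π_λ(x)`:
`(s, t) ↦ λ (x₁ - x₃ x₄ + x₄ s - x₂ t + x₄ t² / 2)`. -/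
def phase (lam : ℝ) (x : G53) (t : ℝ × ℝ) : ℝ :=
  lam * (x.x₁ - x.x₃ * x.x₄ + x.x₄ * t.1 - x.x₂ * t.2 + 1 / 2 * x.x₄ * t.2 ^ 2)

theorem hasTemperateGrowth_phase (lam : ℝ) (x : G53) : (phase lam x).HasTemperateGrowth :=
  (Function.HasTemperateGrowth.const lam).mul
    ((((Function.HasTemperateGrowth.const (x.x₁ - x.x₃ * x.x₄)).add
      ((Function.HasTemperateGrowth.const x.x₄).mul hasTemperateGrowth_fst)).sub
      ((Function.HasTemperateGrowth.const x.x₂).mul hasTemperateGrowth_snd)).add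
      ((Function.HasTemperateGrowth.const (1 / 2 * x.x₄)).mul (hasTemperateGrowth_snd.pow 2)))

/-- The representation `π_λ` of `G_{5,3}`, on its space `𝓢(ℝ²)` of smooth vectors:
`π_λ(x) g (s, t) = e^{2π i λ (x₁ - x₃ x₄ + x₄ s - x₂ t + x₄ t² / 2)} g(s - x₃, t - x₅)`. -/
def rep (lam : ℝ) : G53 →* (𝓢(ℝ × ℝ, ℂ) →L[ℂ] 𝓢(ℝ × ℝ, ℂ)) where
  toFun x := phaseShift (phase lam x) (x.x₃, x.x₅)
  map_one' := by
    ext g t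
    rw [phaseShift_apply (hasTemperateGrowth_phase lam 1)]
    have h0 : t - ((0 : ℝ), (0 : ℝ)) = t := sub_zero t
    simp [phase, one_def, h0]
  map_mul' x y := by
    ext g t
    rw [mul_apply_eq_comp, phaseShift_apply (hasTemperateGrowth_phase lam _),
      phaseShift_apply (hasTemperateGrowth_phase lam _),
      phaseShift_apply (hasTemperateGrowth_phase lam _), ← mul_assoc, ← Complex.exp_add]
    congr 2
    · simp only [phase, mul_def, Prod.fst_sub, Prod.snd_sub]
      push_cast
      ring
    · ext <;> simp only [mul_def, Prod.fst_sub, Prod.snd_sub] <;> ring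

theorem rep_apply (lam : ℝ) (x : G53) (g : 𝓢(ℝ × ℝ, ℂ)) (t : ℝ × ℝ) :
    rep lam x g t = Complex.exp (2 * Real.pi * Complex.I *
      ((lam * (x.x₁ - x.x₃ * x.x₄ + x.x₄ * t.1 - x.x₂ * t.2 + 1 / 2 * x.x₄ * t.2 ^ 2) : ℝ) : ℂ)) *
      g (t - (x.x₃, x.x₅)) :=
  phaseShift_apply (hasTemperateGrowth_phase lam x) _ g t

/-- The section `(x₂, x₃, x₄, x₅) ↦ (0, x₂, x₃, x₄, x₅)` of `G_{5,3} → G_{5,3}/Z`. -/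
def ofQuot (x : ℝ × ℝ × ℝ × ℝ) : G53 := ⟨0, x.1, x.2.1, x.2.2.1, x.2.2.2⟩

/-- The representation coefficient `V_g^{π_λ} f (x) = ⟨f, π_λ(x) g⟩`. -/
def coeff (lam : ℝ) (g : 𝓢(ℝ × ℝ, ℂ)) (f : 𝓢'(ℝ × ℝ, ℂ)) (x : G53) : ℂ :=
  distPairing f (rep lam x g)

/-- The coorbit space `Co_{π_λ} L^p(G_{5,3}/Z)`, with window `g`: the tempered distributions `f`
with `V_g^{π_λ} f ∈ L^p(G_{5,3}/Z)`, where `G_{5,3}/Z` is identified with `ℝ⁴` by the section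
above and its Haar measure is `dx₂ dx₃ dx₄ dx₅`. -/
def coorbitSpace (lam : ℝ) (p : ℝ≥0∞) (g : 𝓢(ℝ × ℝ, ℂ)) : Set 𝓢'(ℝ × ℝ, ℂ) :=
  {f | MemLp (fun x => coeff lam g f (ofQuot x)) p volume}

end G53

end

noncomputable section

open Filter Topology LineDeriv

/-! ### Unimodular exponentials and Fresnel integrals -/

/-! Write α = 1/p and test both spaces on the functions e^{2πi(R u₁ + η u₂ + r u₂²/2)} G(u)
(`chirpDist`). Up to unimodular factors, both of their transforms are values of one kernel,
`chirpKernel`. For the short-time Fourier transform the chirp rate is the constant -r, and (R, η) is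
only a frequency translation (`stft_chirpDist`). For π_λ the coordinate x₄ multiplies both s and
t²/2, so the chirp rate moves with the first frequency: after a linear change of variables it is ω₁
+ R - r (`coeff_chirpDist`, `exists_eLpNorm_coeff_chirpDist`). At chirp rate of size R the kernel
has height R^{-1/2} and spreads over a length R in ω₂, so its L^p norm is of order R^{α-1/2}.

Suppose that the two spaces coincide. Then their norms are comparable on suitably equicontinuous
families (`exists_bound_of_inclusion`). For r = 0 the coorbit norm is of order R^{α-1/2} and the
modulation norm of order m(0,(R,η)), hence m(0,(R,η)) is of order R^{α-1/2}, uniformly in η. For r =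
R and η = 0 the coorbit norm is of order 1, while the modulation norm is the product of the
spreading factor R^{α-1/2} and of the weight R^{α-1/2}. Thus R^{2α-1} would be bounded above and
below, which forces p = 2. Each range of p needs half of this: for p < 2 a lower bound of m
(`exists_weight_lower_bound`), for p > 2 an upper bound (`exists_weight_upper_bound`), each followed
by the opposite inclusion on chirps with r = R.

Upper bounds of norms come from the dispersive decay `kernelBound_decay`, in the form
`exists_chirpKernel_le_majorant`. Lower bounds at large chirp rate come from stationary phase
(`tendsto_chirpKernel`) and Fatou's lemma; they require `fresnelLim_ne_zero`. -/

/-- The unimodular exponential `e^{2π i θ}`. -/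
def phaseExp (θ : ℝ) : ℂ := Complex.exp (2 * Real.pi * Complex.I * (θ : ℂ))

theorem norm_phaseExp (θ : ℝ) : ‖phaseExp θ‖ = 1 := by
  have := Complex.norm_exp_ofReal_mul_I (2 * Real.pi * θ)
  rw [← this, phaseExp]; push_cast; ring_nf

theorem phaseExp_add (a b : ℝ) : phaseExp (a + b) = phaseExp a * phaseExp b := by
  rw [phaseExp, phaseExp, phaseExp, ← Complex.exp_add]; push_cast; ring_nf

theorem phaseExp_zero : phaseExp 0 = 1 := by simp [phaseExp]

theorem conj_phaseExp (a : ℝ) : (starRingEnd ℂ) (phaseExp a) = phaseExp (-a) := by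
  rw [phaseExp, phaseExp, ← Complex.exp_conj]; simp [Complex.conj_ofNat]

@[fun_prop]
theorem continuous_phaseExp : Continuous phaseExp := by unfold phaseExp; fun_prop

theorem hasDerivAt_phaseExp (θ : ℝ) :
    HasDerivAt phaseExp (2 * Real.pi * Complex.I * phaseExp θ) θ := by
  have h := (((hasDerivAt_id (θ : ℂ)).const_mul (2 * Real.pi * Complex.I)).cexp).comp_ofReal
  exact h.congr_deriv (by simp [phaseExp, mul_comm])

theorem HasDerivAt.phaseExp {f : ℝ → ℝ} {f' x : ℝ} (h : HasDerivAt f f' x) :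
    HasDerivAt (fun y => phaseExp (f y)) (f' * (2 * Real.pi * Complex.I) * _root_.phaseExp (f x)) x := by
  exact ((hasDerivAt_phaseExp (f x)).scomp x h).congr_deriv (by simp [mul_assoc])

/-- The Fresnel integral `∫₀^v e^{-π i x²} dx`. -/
def fresnel (v : ℝ) : ℂ := ∫ x in (0 : ℝ)..v, phaseExp (-(x ^ 2 / 2))

theorem hasDerivAt_fresnel (v : ℝ) : HasDerivAt fresnel (phaseExp (-(v ^ 2 / 2))) v := by
  have hc : Continuous fun x : ℝ => phaseExp (-(x ^ 2 / 2)) := by fun_prop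
  exact intervalIntegral.integral_hasDerivAt_right (hc.intervalIntegrable _ _)
    (hc.stronglyMeasurableAtFilter _ _) hc.continuousAt

theorem continuous_fresnel : Continuous fresnel :=
  continuous_iff_continuousAt.2 fun v => (hasDerivAt_fresnel v).continuousAt

theorem fresnel_neg (v : ℝ) : fresnel (-v) = -fresnel v := by
  have h := intervalIntegral.integral_comp_neg (a := 0) (b := v)
    (fun x : ℝ => phaseExp (-(x ^ 2 / 2)))
  simp only [neg_zero, neg_sq] at h
  rw [fresnel, fresnel, intervalIntegral.integral_symm, h]

/-- One integration by parts: adding the boundary term e^{-πiv²}/(2πiv) leaves a function whose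
derivative is O(v⁻²), hence integrable at infinity. -/
theorem exists_tendsto_fresnel : ∃ c : ℂ, Tendsto fresnel atTop (𝓝 c) := by
  set k : ℂ := 2 * Real.pi * Complex.I with hk
  have hk0 : k ≠ 0 := Complex.two_pi_I_ne_zero
  set D : ℝ → ℂ := fun v => fresnel v + phaseExp (-(v ^ 2 / 2)) * (k⁻¹ * ((v⁻¹ : ℝ) : ℂ)) with hD
  set D' : ℝ → ℂ := fun v => -(phaseExp (-(v ^ 2 / 2)) * k⁻¹ * (((v ^ 2)⁻¹ : ℝ) : ℂ)) with hD'
  have hder : ∀ v ∈ Set.Ioi (1 : ℝ), HasDerivAt D (D' v) v := by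
    intro v hv
    have hv0 : v ≠ 0 := by have : (1 : ℝ) < v := hv; positivity
    have hvc : (v : ℂ) ≠ 0 := by exact_mod_cast hv0
    have h1 : HasDerivAt (fun y : ℝ => -(y ^ 2 / 2)) (-v) v :=
      ((hasDerivAt_pow 2 v).div_const 2).neg.congr_deriv (by simp)
    have h2 := h1.phaseExp
    have h3 : HasDerivAt (fun y : ℝ => k⁻¹ * ((y⁻¹ : ℝ) : ℂ)) (k⁻¹ * ((-(v ^ 2)⁻¹ : ℝ) : ℂ)) v :=
      ((hasDerivAt_inv hv0).ofReal_comp).const_mul _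
    have h4 := (hasDerivAt_fresnel v).add (h2.mul h3)
    refine h4.congr_deriv ?_
    simp only [hD', ← hk]
    push_cast
    field_simp
    ring
  have hint : IntegrableOn D' (Set.Ioi 1) := by
    have h0 : IntegrableOn (fun v : ℝ => v ^ (-2 : ℝ)) (Set.Ioi 1) :=
      integrableOn_Ioi_rpow_of_lt (by norm_num) one_pos
    refine Integrable.mono' (h0.const_mul ‖k⁻¹‖) ?_ ?_
    · apply Measurable.aestronglyMeasurable
      have := continuous_phaseExp.measurable
      simp only [hD']
      fun_prop
    · filter_upwards [self_mem_ae_restrict measurableSet_Ioi] with v hv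
      have hv1 : (1 : ℝ) < v := hv
      simp only [hD', norm_neg, norm_mul, norm_phaseExp, one_mul]
      rw [Complex.norm_real, Real.norm_of_nonneg (by positivity), Real.rpow_neg (by linarith)]
      norm_num
  have hl := tendsto_limUnder_of_hasDerivAt_of_integrableOn_Ioi hder hint
  have hz : Tendsto (fun v : ℝ => phaseExp (-(v ^ 2 / 2)) * (k⁻¹ * ((v⁻¹ : ℝ) : ℂ))) atTop (𝓝 0) := by
    rw [tendsto_zero_iff_norm_tendsto_zero]
    have : Tendsto (fun v : ℝ => ‖k⁻¹‖ * ‖v⁻¹‖) atTop (𝓝 0) := by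
      have := (tendsto_inv_atTop_zero (𝕜 := ℝ)).norm.const_mul ‖k⁻¹‖
      simpa using this
    refine this.congr fun v => ?_
    rw [norm_mul, norm_mul, norm_phaseExp, one_mul, Complex.norm_real]
  refine ⟨limUnder atTop D - 0, (hl.sub hz).congr fun v => ?_⟩
  simp [hD]

/-- The limit of the Fresnel integral at infinity. -/
def fresnelLim : ℂ := exists_tendsto_fresnel.choose

theorem tendsto_fresnel_atTop : Tendsto fresnel atTop (𝓝 fresnelLim) :=
  exists_tendsto_fresnel.choose_spec

theorem tendsto_fresnel_atBot : Tendsto fresnel atBot (𝓝 (-fresnelLim)) := by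
  refine (tendsto_fresnel_atTop.comp tendsto_neg_atBot_atTop).neg.congr fun v => ?_
  simp [fresnel_neg]

theorem exists_norm_fresnel_le : ∃ C : ℝ, 0 ≤ C ∧ ∀ v, ‖fresnel v‖ ≤ C := by
  have h1 : ∀ᶠ v in atTop, ‖fresnel v‖ ≤ ‖fresnelLim‖ + 1 :=
    (tendsto_fresnel_atTop.norm.eventually (ge_mem_nhds (by linarith)))
  obtain ⟨M, hM⟩ := eventually_atTop.1 h1
  obtain ⟨C, hC⟩ := (isCompact_Icc (a := -|M|) (b := |M|)).exists_bound_of_continuousOn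
    continuous_fresnel.continuousOn
  refine ⟨max C (‖fresnelLim‖ + 1), le_max_of_le_right (by positivity), fun v => ?_⟩
  by_cases hv : |v| ≤ |M|
  · exact (hC v (abs_le.1 hv)).trans (le_max_left _ _)
  · refine le_max_of_le_right ?_
    have hv' : M ≤ |v| := (le_abs_self M).trans (not_le.1 hv).le
    have := hM _ hv'
    rcases abs_cases v with ⟨h, _⟩ | ⟨h, _⟩
    · rwa [h] at this
    · rwa [h, fresnel_neg, norm_neg] at this

/-- A bounded primitive of a one-dimensional chirp, with the dispersive bound `|r|^{-1/2}`. -/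
theorem exists_chirp_primitive : ∃ C : ℝ, 0 ≤ C ∧ ∀ r b : ℝ, r ≠ 0 → ∃ P : ℝ → ℂ,
    (∀ t, HasDerivAt P (phaseExp (-(b * t + r / 2 * t ^ 2))) t) ∧ ∀ t, √|r| * ‖P t‖ ≤ C := by
  obtain ⟨C, hC0, hC⟩ := exists_norm_fresnel_le
  refine ⟨C, hC0, ?_⟩
  have key : ∀ r b : ℝ, 0 < r → ∃ P : ℝ → ℂ,
      (∀ t, HasDerivAt P (phaseExp (-(b * t + r / 2 * t ^ 2))) t) ∧ ∀ t, √|r| * ‖P t‖ ≤ C := by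
    intro r b hr
    have hs : √r ≠ 0 := (Real.sqrt_pos.2 hr).ne'
    have hsq : √r ^ 2 = r := Real.sq_sqrt hr.le
    -- Completing the square, b t + r t²/2 = r (t + b/r)²/2 - b²/(2r), reduces the chirp to the
    -- Fresnel integral at √r (t + b/r).
    refine ⟨fun t => phaseExp (b ^ 2 / (2 * r)) * ((√r)⁻¹ • fresnel (√r * (t + b / r))),
      fun t => ?_, fun t => ?_⟩
    · have h1 : HasDerivAt (fun t : ℝ => √r * (t + b / r)) (√r) t := by
        simpa using ((hasDerivAt_id t).add_const (b / r)).const_mul (√r)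
      have h2 := (((hasDerivAt_fresnel _).scomp t h1).const_smul (√r)⁻¹).const_mul
        (phaseExp (b ^ 2 / (2 * r)))
      refine h2.congr_deriv ?_
      rw [smul_smul, inv_mul_cancel₀ hs, one_smul, ← phaseExp_add, mul_pow, hsq]
      congr 1
      field_simp
      ring
    · rw [norm_mul, norm_phaseExp, one_mul, norm_smul, norm_inv, Real.norm_of_nonneg (Real.sqrt_nonneg _),
        abs_of_pos hr, mul_inv_cancel_left₀ hs]
      exact hC _
  intro r b hr
  rcases lt_or_gt_of_ne hr with h | h
  · obtain ⟨P, hP, hb⟩ := key (-r) (-b) (by linarith)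
    refine ⟨fun t => (starRingEnd ℂ) (P t), fun t => ?_, fun t => ?_⟩
    · have := (hP t).star
      refine this.congr_deriv ?_
      rw [Complex.star_def, conj_phaseExp]
      congr 1
      ring
    · simpa using hb t
  · exact key r b h

/-- If the limit vanished, dominated convergence would send the pairing of `fresnel (√n t)` with the
derivative of a Gaussian to 0. Integration by parts turns that pairing into a complex Gaussian
integral of modulus √n |1 + i n|^{-1/2}, which is at least 1/√2 for n ≥ 1. -/
theorem fresnelLim_ne_zero : fresnelLim ≠ 0 := by
  intro h0
  obtain ⟨C, hC0, hC⟩ := exists_norm_fresnel_le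
  set G : ℝ → ℂ := fun t => Complex.exp (-(Real.pi : ℂ) * (t : ℂ) ^ 2) with hG
  set G' : ℝ → ℂ := fun t => -(2 * Real.pi) * ((t : ℂ) * Complex.exp (-(Real.pi : ℂ) * (t : ℂ) ^ 2)) with hG'
  have hpi : 0 < (Real.pi : ℂ).re := by simpa using Real.pi_pos
  have hGi : Integrable G := integrable_cexp_neg_mul_sq hpi
  have hG'i : Integrable G' := (integrable_mul_cexp_neg_mul_sq hpi).const_mul _
  have hGd : ∀ t, HasDerivAt G (G' t) t := by
    intro t
    have := (((hasDerivAt_pow 2 (t : ℂ)).const_mul (-(Real.pi : ℂ))).cexp).comp_ofReal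
    convert this using 1
    simp only [hG']
    push_cast
    ring
  have hlim : ∀ t : ℝ, t ≠ 0 → Tendsto (fun n : ℕ => fresnel (√n * t)) atTop (𝓝 0) := by
    intro t ht
    have hs : Tendsto (fun n : ℕ => √(n : ℝ)) atTop atTop :=
      Real.tendsto_sqrt_atTop.comp tendsto_natCast_atTop_atTop
    rcases lt_or_gt_of_ne ht with h | h
    · have := tendsto_fresnel_atBot.comp (hs.atTop_mul_const_of_neg h)
      simpa [h0, Function.comp_def] using this
    · have := tendsto_fresnel_atTop.comp (hs.atTop_mul_const h)
      simpa [h0, Function.comp_def] using this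
  have hdct : Tendsto (fun n : ℕ => ∫ t, G' t * fresnel (√n * t)) atTop (𝓝 (∫ _ : ℝ, (0 : ℂ))) := by
    refine tendsto_integral_of_dominated_convergence (fun t => ‖G' t‖ * C) ?_ (hG'i.norm.mul_const C) ?_ ?_
    · intro n
      exact hG'i.aestronglyMeasurable.mul
        (continuous_fresnel.comp (by fun_prop)).aestronglyMeasurable
    · intro n
      filter_upwards with t
      rw [norm_mul]
      gcongr
      exact hC _
    · have : ∀ᵐ t : ℝ, t ≠ 0 := by simp [ae_iff]
      filter_upwards [this] with t ht
      simpa using (hlim t ht).const_mul (G' t)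
  have hval : ∀ n : ℕ, ‖∫ t, G' t * fresnel (√n * t)‖ = √n * ‖(1 + Complex.I * n : ℂ)‖ ^ (-(1/2) : ℝ) := by
    intro n
    have hd : ∀ t : ℝ, HasDerivAt (fun t : ℝ => fresnel (√n * t)) (√n * phaseExp (-(n * t ^ 2 / 2))) t := by
      intro t
      have h1 : HasDerivAt (fun t : ℝ => √(n : ℝ) * t) (√n) t := by
        simpa using (hasDerivAt_id t).const_mul (√(n : ℝ))
      have := (hasDerivAt_fresnel _).scomp t h1
      refine this.congr_deriv ?_
      rw [mul_pow, Real.sq_sqrt (Nat.cast_nonneg n)]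
      simp
    have hbd : ∀ f : ℝ → ℂ, Integrable f → Integrable (fun t => f t * fresnel (√n * t)) := by
      intro f hf
      exact hf.mul_bdd (c := C) (continuous_fresnel.comp (by fun_prop)).aestronglyMeasurable
        (by filter_upwards with t using hC _)
    have hip := integral_mul_deriv_eq_deriv_mul_of_integrable (u := G) (u' := G')
      (v := fun t : ℝ => fresnel (√n * t)) (v' := fun t => √n * phaseExp (-(n * t ^ 2 / 2)))
      (fun t _ => hGd t) (fun t _ => hd t)
      (hGi.mul_bdd (c := √n) (by fun_prop) (by
        filter_upwards with t
        rw [norm_mul, norm_phaseExp, Complex.norm_real]; simp [abs_of_nonneg]))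
      (hbd _ hG'i) (hbd _ hGi)
    rw [← norm_neg, ← hip]
    have h1 : ∀ t : ℝ, G t * (√n * phaseExp (-(n * t ^ 2 / 2))) =
        √n * Complex.exp (-(Real.pi * (1 + Complex.I * n)) * (t : ℂ) ^ 2) := by
      intro t
      simp only [hG, phaseExp]
      rw [mul_left_comm, ← Complex.exp_add]
      push_cast
      ring_nf
    simp_rw [h1]
    have hne : (1 + Complex.I * n : ℂ) ≠ 0 := by
      intro h
      have := congrArg Complex.re h
      simp at this
    rw [integral_const_mul, integral_gaussian_complex (by simpa using Real.pi_pos), norm_mul, Complex.norm_real,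
      Real.norm_of_nonneg (Real.sqrt_nonneg _)]
    congr 1
    have hpc : (Real.pi : ℂ) ≠ 0 := by exact_mod_cast Real.pi_ne_zero
    rw [show (Real.pi : ℂ) / (Real.pi * (1 + Complex.I * n)) = (1 + Complex.I * n)⁻¹ by
      field_simp]
    rw [show (1 / 2 : ℂ) = ((1 / 2 : ℝ) : ℂ) by push_cast; ring, Complex.norm_cpow_real, norm_inv, Real.inv_rpow (norm_nonneg _),
      Real.rpow_neg (norm_nonneg _)]
  have hge : ∀ n : ℕ, 1 ≤ n → (√2)⁻¹ ≤ ‖∫ t, G' t * fresnel (√n * t)‖ := by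
    intro n hn
    have hn' : (1 : ℝ) ≤ n := by exact_mod_cast hn
    rw [hval n]
    have hb : ‖(1 + Complex.I * n : ℂ)‖ ≤ 2 * n := by
      refine (norm_add_le _ _).trans ?_
      simp
      linarith
    have hpos : 0 < ‖(1 + Complex.I * n : ℂ)‖ := by
      rw [norm_pos_iff]
      intro h
      have := congrArg Complex.re h
      simp at this
    have h2 : (2 * n : ℝ) ^ (-(1/2) : ℝ) ≤ ‖(1 + Complex.I * n : ℂ)‖ ^ (-(1/2) : ℝ) :=
      Real.rpow_le_rpow_of_nonpos hpos hb (by norm_num)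
    refine le_trans ?_ (mul_le_mul_of_nonneg_left h2 (Real.sqrt_nonneg _))
    rw [Real.rpow_neg (by positivity), ← Real.sqrt_eq_rpow, Real.sqrt_mul (by norm_num), mul_inv]
    have : √(n : ℝ) ≠ 0 := by positivity
    rw [mul_left_comm, mul_inv_cancel₀ this, mul_one]
  have hz := hdct.norm
  simp only [integral_zero, norm_zero] at hz
  have := ge_of_tendsto hz (eventually_atTop.2 ⟨1, hge⟩)
  have h2 : 0 < (√2 : ℝ)⁻¹ := by positivity
  linarith

/-! ### The chirped short-time Fourier kernel -/

/-- The chirped kernel `∫ F(u) conj (γ(u - x)) e^{-2π i (ω · u + r u₂² / 2)} du`. -/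
def chirpKernel (F γ : 𝓢(ℝ × ℝ, ℂ)) (r : ℝ) (x ω : ℝ × ℝ) : ℂ :=
  ∫ u : ℝ × ℝ, F u * (starRingEnd ℂ) (γ (u - x)) *
    phaseExp (-(ω.1 * u.1 + ω.2 * u.2 + r / 2 * u.2 ^ 2))

/-- The `L¹` norm of a Schwartz function on the plane. -/
def schwartzL1 (F : 𝓢(ℝ × ℝ, ℂ)) : ℝ := ∫ u, ‖F u‖

theorem continuous_schwartzL1 : Continuous schwartzL1 := by
  have h : schwartzL1 = fun F : 𝓢(ℝ × ℝ, ℂ) => ‖F.toLp 1 volume‖ := by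
    funext F
    rw [norm_toLp_one, schwartzL1]
  rw [h]
  exact continuous_norm.comp continuous_toLp

theorem schwartzL1_zero : schwartzL1 0 = 0 := by simp [schwartzL1]

theorem schwartzL1_nonneg (F : 𝓢(ℝ × ℝ, ℂ)) : 0 ≤ schwartzL1 F :=
  integral_nonneg fun _ => norm_nonneg _

theorem norm_integral_schwartz_mul_le (F : 𝓢(ℝ × ℝ, ℂ)) {h : ℝ × ℝ → ℂ} {C : ℝ}
    (hC : ∀ u, ‖h u‖ ≤ C) : ‖∫ u, F u * h u‖ ≤ schwartzL1 F * C := by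
  rw [schwartzL1, ← integral_mul_const]
  refine norm_integral_le_of_norm_le (F.integrable.norm.mul_const C) ?_
  filter_upwards with u
  rw [norm_mul]
  gcongr
  exact hC u

theorem integrable_schwartz_mul (F : 𝓢(ℝ × ℝ, ℂ)) {h : ℝ × ℝ → ℂ} {C : ℝ} (hc : Continuous h)
    (hC : ∀ u, ‖h u‖ ≤ C) : Integrable fun u => F u * h u :=
  F.integrable.mul_bdd (c := C) hc.aestronglyMeasurable (by filter_upwards with u using hC u)

/-- The sup norm bound of a Schwartz function. -/
def schwartzSup (γ : 𝓢(ℝ × ℝ, ℂ)) : ℝ := SchwartzMap.seminorm ℝ 0 0 γ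

theorem norm_le_schwartzSup (γ : 𝓢(ℝ × ℝ, ℂ)) (u : ℝ × ℝ) : ‖γ u‖ ≤ schwartzSup γ :=
  norm_le_seminorm ℝ γ u

theorem schwartzSup_nonneg (γ : 𝓢(ℝ × ℝ, ℂ)) : 0 ≤ schwartzSup γ := apply_nonneg _ _

theorem norm_chirpKernel_integrand (γ : 𝓢(ℝ × ℝ, ℂ)) (x u : ℝ × ℝ) (θ : ℝ) :
    ‖(starRingEnd ℂ) (γ (u - x)) * phaseExp θ‖ ≤ schwartzSup γ := by
  rw [norm_mul, norm_phaseExp, mul_one, RCLike.norm_conj]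
  exact norm_le_schwartzSup _ _

theorem integrable_chirpKernel (F γ : 𝓢(ℝ × ℝ, ℂ)) (r : ℝ) (x ω : ℝ × ℝ) :
    Integrable fun u : ℝ × ℝ => F u * (starRingEnd ℂ) (γ (u - x)) *
      phaseExp (-(ω.1 * u.1 + ω.2 * u.2 + r / 2 * u.2 ^ 2)) := by
  have hγ := γ.continuous
  have := integrable_schwartz_mul F (h := fun u => (starRingEnd ℂ) (γ (u - x)) *
    phaseExp (-(ω.1 * u.1 + ω.2 * u.2 + r / 2 * u.2 ^ 2))) (by fun_prop)
    (fun u => norm_chirpKernel_integrand γ x u _)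
  simpa [mul_assoc] using this

theorem norm_chirpKernel_le (F γ : 𝓢(ℝ × ℝ, ℂ)) (r : ℝ) (x ω : ℝ × ℝ) :
    ‖chirpKernel F γ r x ω‖ ≤ schwartzL1 F * schwartzSup γ := by
  simp only [chirpKernel, mul_assoc]
  exact norm_integral_schwartz_mul_le F fun u => norm_chirpKernel_integrand γ x u _

theorem Continuous.chirpKernel {T : Type*} [TopologicalSpace T] [FirstCountableTopology T]
    (F γ : 𝓢(ℝ × ℝ, ℂ)) {a : T → ℝ} {x ω : T → ℝ × ℝ} (ha : Continuous a) (hx : Continuous x)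
    (hω : Continuous ω) : Continuous fun t => _root_.chirpKernel F γ (a t) (x t) (ω t) := by
  have hF := F.continuous
  have hγ := γ.continuous
  refine continuous_of_dominated (bound := fun u => ‖F u‖ * schwartzSup γ) ?_ ?_
    (F.integrable.norm.mul_const _) ?_
  · intro z
    exact (integrable_chirpKernel F γ _ _ _).aestronglyMeasurable
  · intro z
    filter_upwards with u
    rw [mul_assoc, norm_mul]
    gcongr
    exact norm_chirpKernel_integrand γ _ u _
  · filter_upwards with u
    fun_prop

/-! ### Integration by parts and moment identities for the chirped kernel. -/

theorem hasLineDerivAt_schwartz (F : 𝓢(ℝ × ℝ, ℂ)) (u v : ℝ × ℝ) :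
    HasLineDerivAt ℝ F (∂_{v} F u) u v := by
  rw [lineDerivOp_apply_eq_fderiv]
  exact F.differentiableAt.hasFDerivAt.hasLineDerivAt v

theorem hasLineDerivAt_conj_translate (γ : 𝓢(ℝ × ℝ, ℂ)) (x u v : ℝ × ℝ) :
    HasLineDerivAt ℝ (fun u => (starRingEnd ℂ) (γ (u - x)))
      ((starRingEnd ℂ) (∂_{v} γ (u - x))) u v := by
  have h := hasLineDerivAt_schwartz γ (u - x) v
  have h2 := HasDerivAt.star h
  simpa only [HasLineDerivAt, add_sub_right_comm, Complex.star_def] using h2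

theorem integral_schwartz_mul_lineDeriv (F : 𝓢(ℝ × ℝ, ℂ)) {v : ℝ × ℝ} {h h' : ℝ × ℝ → ℂ} {C : ℝ}
    (hd : ∀ u, HasLineDerivAt ℝ h (h' u) u v) (hc : Continuous h) (hC : ∀ u, ‖h u‖ ≤ C)
    (hi : Integrable fun u => F u * h' u) : ∫ u, F u * h' u = -∫ u, ∂_{v} F u * h u :=
  integral_bilinear_hasLineDerivAt_right_eq_neg_left_of_integrable
    (B := ContinuousLinearMap.mul ℝ ℂ) (integrable_schwartz_mul _ hc hC) hi
    (integrable_schwartz_mul _ hc hC) (fun u _ => hasLineDerivAt_schwartz F u v) (fun u _ => hd u)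

/-- Multiplication of Schwartz functions by the first coordinate. -/
def mulFst : 𝓢(ℝ × ℝ, ℂ) →L[ℂ] 𝓢(ℝ × ℝ, ℂ) := smulLeftCLM ℂ fun u : ℝ × ℝ => (u.1 : ℂ)

/-- Multiplication of Schwartz functions by the second coordinate. -/
def mulSnd : 𝓢(ℝ × ℝ, ℂ) →L[ℂ] 𝓢(ℝ × ℝ, ℂ) := smulLeftCLM ℂ fun u : ℝ × ℝ => (u.2 : ℂ)

theorem mulFst_apply (F : 𝓢(ℝ × ℝ, ℂ)) (u : ℝ × ℝ) : mulFst F u = u.1 * F u := by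
  have h : (fun u : ℝ × ℝ => (u.1 : ℂ)).HasTemperateGrowth :=
    (Complex.ofRealCLM.comp (ContinuousLinearMap.fst ℝ ℝ ℝ)).hasTemperateGrowth
  simp [mulFst, smulLeftCLM_apply_apply h]

theorem mulSnd_apply (F : 𝓢(ℝ × ℝ, ℂ)) (u : ℝ × ℝ) : mulSnd F u = u.2 * F u := by
  have h : (fun u : ℝ × ℝ => (u.2 : ℂ)).HasTemperateGrowth :=
    (Complex.ofRealCLM.comp (ContinuousLinearMap.snd ℝ ℝ ℝ)).hasTemperateGrowth
  simp [mulSnd, smulLeftCLM_apply_apply h]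

theorem fst_mul_chirpKernel (F γ : 𝓢(ℝ × ℝ, ℂ)) (r : ℝ) (x ω : ℝ × ℝ) :
    x.1 * chirpKernel F γ r x ω = chirpKernel (mulFst F) γ r x ω - chirpKernel F (mulFst γ) r x ω := by
  unfold chirpKernel
  rw [← integral_const_mul, ← integral_sub (integrable_chirpKernel _ _ _ _ _)
    (integrable_chirpKernel _ _ _ _ _)]
  congr 1
  funext u
  simp only [mulFst_apply, map_mul, Complex.conj_ofReal, Prod.fst_sub]
  push_cast
  ring

theorem snd_mul_chirpKernel (F γ : 𝓢(ℝ × ℝ, ℂ)) (r : ℝ) (x ω : ℝ × ℝ) :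
    x.2 * chirpKernel F γ r x ω = chirpKernel (mulSnd F) γ r x ω - chirpKernel F (mulSnd γ) r x ω := by
  unfold chirpKernel
  rw [← integral_const_mul, ← integral_sub (integrable_chirpKernel _ _ _ _ _)
    (integrable_chirpKernel _ _ _ _ _)]
  congr 1
  funext u
  simp only [mulSnd_apply, map_mul, Complex.conj_ofReal, Prod.snd_sub]
  push_cast
  ring

/-- Integration by parts along v. Differentiating the chirp produces r u₂ v₂ besides ω · v; this
extra term is the reason why decay in ω₂ holds only at scale 1 + |r|. -/
theorem freq_mul_chirpKernel (F γ : 𝓢(ℝ × ℝ, ℂ)) (r : ℝ) (x ω v : ℝ × ℝ) :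
    2 * Real.pi * Complex.I * (((ω.1 * v.1 + ω.2 * v.2 : ℝ) : ℂ) * chirpKernel F γ r x ω +
      ((r * v.2 : ℝ) : ℂ) * chirpKernel (mulSnd F) γ r x ω) =
      chirpKernel (∂_{v} F) γ r x ω + chirpKernel F (∂_{v} γ) r x ω := by
  set ψ : ℝ × ℝ → ℝ := fun u => -(ω.1 * u.1 + ω.2 * u.2 + r / 2 * u.2 ^ 2) with hψ
  set h : ℝ × ℝ → ℂ := fun u => (starRingEnd ℂ) (γ (u - x)) * phaseExp (ψ u) with hh
  set h' : ℝ × ℝ → ℂ := fun u => (starRingEnd ℂ) (∂_{v} γ (u - x)) * phaseExp (ψ u) +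
    (starRingEnd ℂ) (γ (u - x)) * (((-(ω.1 * v.1 + ω.2 * v.2 + r * u.2 * v.2) : ℝ) : ℂ) *
      (2 * Real.pi * Complex.I) * phaseExp (ψ u)) with hh'
  have hd : ∀ u, HasLineDerivAt ℝ h (h' u) u v := by
    intro u
    have h1 : HasDerivAt (fun t : ℝ => ψ (u + t • v))
        (-(ω.1 * v.1 + ω.2 * v.2 + r * u.2 * v.2)) 0 := by
      have e1 : HasDerivAt (fun t : ℝ => u.1 + t * v.1) v.1 0 := by
        simpa using ((hasDerivAt_id (0 : ℝ)).mul_const v.1).const_add u.1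
      have e2 : HasDerivAt (fun t : ℝ => u.2 + t * v.2) v.2 0 := by
        simpa using ((hasDerivAt_id (0 : ℝ)).mul_const v.2).const_add u.2
      refine ((((e1.const_mul ω.1).add (e2.const_mul ω.2)).add
        ((e2.pow 2).const_mul (r / 2))).neg).congr_deriv ?_
      simp
      ring
    have h2 := HasDerivAt.mul (hasLineDerivAt_conj_translate γ x u v) h1.phaseExp
    refine h2.congr_deriv ?_
    simp [hh']
  have hγ := γ.continuous
  have hc : Continuous h := by fun_prop
  have hsplit : ∀ u, F u * h' u =
      F u * (starRingEnd ℂ) (∂_{v} γ (u - x)) * phaseExp (ψ u) -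
      ((2 * Real.pi * Complex.I) * (((ω.1 * v.1 + ω.2 * v.2 : ℝ) : ℂ) *
        (F u * (starRingEnd ℂ) (γ (u - x)) * phaseExp (ψ u)) +
        ((r * v.2 : ℝ) : ℂ) * (mulSnd F u * (starRingEnd ℂ) (γ (u - x)) * phaseExp (ψ u)))) := by
    intro u
    simp only [hh', mulSnd_apply]
    push_cast
    ring
  have i1 := integrable_chirpKernel F (∂_{v} γ) r x ω
  have i2 := (integrable_chirpKernel F γ r x ω).const_mul ((ω.1 * v.1 + ω.2 * v.2 : ℝ) : ℂ)
  have i3 := (integrable_chirpKernel (mulSnd F) γ r x ω).const_mul ((r * v.2 : ℝ) : ℂ)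
  have i4 := (i2.add i3).const_mul (2 * Real.pi * Complex.I)
  have hi : Integrable fun u => F u * h' u := by
    simp_rw [hsplit]
    exact i1.sub i4
  have hmain := integral_schwartz_mul_lineDeriv F hd hc
    (fun u => norm_chirpKernel_integrand γ x u _) hi
  have e1 := integral_add i2 i3
  rw [integral_const_mul, integral_const_mul] at e1
  have hL := (integral_congr_ae (ae_of_all _ hsplit)).trans ((integral_sub i1 i4).trans
    (congrArg₂ _ rfl ((integral_const_mul _ _).trans (congrArg _ e1))))
  have e : ∫ u, ∂_{v} F u * h u = chirpKernel (∂_{v} F) γ r x ω := by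
    simp only [chirpKernel, hh, mul_assoc]
    rfl
  rw [e, hL] at hmain
  have hmain' : chirpKernel F (∂_{v} γ) r x ω -
      2 * Real.pi * Complex.I * (((ω.1 * v.1 + ω.2 * v.2 : ℝ) : ℂ) * chirpKernel F γ r x ω +
      ((r * v.2 : ℝ) : ℂ) * chirpKernel (mulSnd F) γ r x ω) = -chirpKernel (∂_{v} F) γ r x ω := hmain
  linear_combination -hmain'

/-- The chirp in u₂ is the derivative of a primitive of size |r|^{-1/2}, uniformly in ω₂;
integrating by parts costs one u₂-derivative on `F` or on `γ`. -/
theorem exists_dispersive_bound : ∃ C : ℝ, 0 ≤ C ∧ ∀ (F γ : 𝓢(ℝ × ℝ, ℂ)) (r : ℝ) (x ω : ℝ × ℝ),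
    √|r| * ‖chirpKernel F γ r x ω‖ ≤
      C * (schwartzL1 F * schwartzSup (∂_{((0 : ℝ), (1 : ℝ))} γ) +
        schwartzL1 (∂_{((0 : ℝ), (1 : ℝ))} F) * schwartzSup γ) := by
  obtain ⟨C, hC0, hC⟩ := exists_chirp_primitive
  refine ⟨C, hC0, fun F γ r x ω => ?_⟩
  have hs1 := schwartzSup_nonneg γ
  have hs2 := schwartzSup_nonneg (∂_{((0 : ℝ), (1 : ℝ))} γ)
  have hl1 := schwartzL1_nonneg F
  have hl2 := schwartzL1_nonneg (∂_{((0 : ℝ), (1 : ℝ))} F)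
  rcases eq_or_ne r 0 with rfl | hr
  · simp only [abs_zero, Real.sqrt_zero, zero_mul]
    positivity
  obtain ⟨P, hP, hPb⟩ := hC r ω.2 hr
  have hsr : 0 < √|r| := Real.sqrt_pos.2 (abs_pos.2 hr)
  have hPb' : ∀ t, ‖P t‖ ≤ C / √|r| := fun t => by
    rw [le_div_iff₀ hsr, mul_comm]; exact hPb t
  set v : ℝ × ℝ := (0, 1) with hv
  set k : ℝ × ℝ → ℂ := fun u => phaseExp (-(ω.1 * u.1)) * P u.2 with hk
  have hkb : ∀ u, ‖k u‖ ≤ C / √|r| := fun u => by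
    rw [hk, norm_mul, norm_phaseExp, one_mul]; exact hPb' _
  have hPc : Continuous P := continuous_iff_continuousAt.2 fun t => (hP t).continuousAt
  have hkc : Continuous k := by fun_prop
  set h : ℝ × ℝ → ℂ := fun u => (starRingEnd ℂ) (γ (u - x)) * k u with hh
  have hbound : ∀ (η : 𝓢(ℝ × ℝ, ℂ)) u, ‖(starRingEnd ℂ) (η (u - x)) * k u‖ ≤
      schwartzSup η * (C / √|r|) := by
    intro η u
    rw [norm_mul, RCLike.norm_conj]
    exact mul_le_mul (norm_le_schwartzSup _ _) (hkb u) (norm_nonneg _) (schwartzSup_nonneg _)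
  set h' : ℝ × ℝ → ℂ := fun u => (starRingEnd ℂ) (∂_{v} γ (u - x)) * k u +
    (starRingEnd ℂ) (γ (u - x)) * phaseExp (-(ω.1 * u.1 + ω.2 * u.2 + r / 2 * u.2 ^ 2)) with hh'
  have hd : ∀ u, HasLineDerivAt ℝ h (h' u) u v := by
    intro u
    have e2 : HasDerivAt (fun t : ℝ => u.2 + t) 1 0 := (hasDerivAt_id (0 : ℝ)).const_add u.2
    have e3 : HasDerivAt P (phaseExp (-(ω.2 * u.2 + r / 2 * u.2 ^ 2))) (u.2 + 0) := by
      rw [add_zero]; exact hP u.2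
    have h1 : HasDerivAt (fun t : ℝ => k (u + t • v))
        (phaseExp (-(ω.1 * u.1 + ω.2 * u.2 + r / 2 * u.2 ^ 2))) 0 := by
      have e4 := (e3.scomp (0 : ℝ) e2).const_mul (phaseExp (-(ω.1 * u.1)))
      have e5 : (fun t : ℝ => k (u + t • v)) =
          fun t => phaseExp (-(ω.1 * u.1)) * (P ∘ fun t => u.2 + t) t := by
        funext t; simp [hk, hv]
      rw [e5]
      refine e4.congr_deriv ?_
      rw [one_smul, ← phaseExp_add]
      congr 1
      ring
    have h2 := HasDerivAt.mul (hasLineDerivAt_conj_translate γ x u v) h1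
    refine h2.congr_deriv ?_
    simp [hh']
  have hγ := γ.continuous
  have hγ' := (∂_{v} γ).continuous
  have i1 : Integrable fun u => F u * ((starRingEnd ℂ) (∂_{v} γ (u - x)) * k u) :=
    integrable_schwartz_mul F (by fun_prop) (hbound _)
  have i2 := integrable_chirpKernel F γ r x ω
  have hsplit : ∀ u, F u * h' u = F u * ((starRingEnd ℂ) (∂_{v} γ (u - x)) * k u) +
      F u * (starRingEnd ℂ) (γ (u - x)) *
        phaseExp (-(ω.1 * u.1 + ω.2 * u.2 + r / 2 * u.2 ^ 2)) := by
    intro u; simp only [hh']; ring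
  have hmain := integral_schwartz_mul_lineDeriv F hd (by fun_prop) (hbound γ)
    (by simp_rw [hsplit]; exact i1.add i2)
  simp_rw [hsplit] at hmain
  rw [integral_add i1 i2] at hmain
  have hK : chirpKernel F γ r x ω = -(∫ u, ∂_{v} F u * h u) -
      ∫ u, F u * ((starRingEnd ℂ) (∂_{v} γ (u - x)) * k u) := by
    rw [← hmain, chirpKernel]; ring
  have hn : ‖chirpKernel F γ r x ω‖ ≤ schwartzL1 (∂_{v} F) * (schwartzSup γ * (C / √|r|)) +
      schwartzL1 F * (schwartzSup (∂_{v} γ) * (C / √|r|)) := by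
    rw [hK]
    refine (norm_sub_le _ _).trans ?_
    rw [norm_neg]
    exact add_le_add (norm_integral_schwartz_mul_le _ (hbound γ))
      (norm_integral_schwartz_mul_le _ (hbound _))
  calc √|r| * ‖chirpKernel F γ r x ω‖ ≤ √|r| * (schwartzL1 (∂_{v} F) * (schwartzSup γ * (C / √|r|)) +
      schwartzL1 F * (schwartzSup (∂_{v} γ) * (C / √|r|))) := by gcongr
    _ = _ := by field_simp; ring

/-- The weight `Θ` times the chirped kernel is bounded by a continuous gauge of `F`,
uniformly in all parameters. -/
def KernelBound (Θ : ℝ → ℝ × ℝ → ℝ × ℝ → ℝ) : Prop :=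
  ∀ γ : 𝓢(ℝ × ℝ, ℂ), ∃ q : 𝓢(ℝ × ℝ, ℂ) → ℝ, Continuous q ∧ q 0 = 0 ∧
    ∀ F r x ω, Θ r x ω * ‖chirpKernel F γ r x ω‖ ≤ q F

/-- Combines the trivial L¹ bound with the dispersive one. Continuity of the gauge and its vanishing
at 0 matter later: with a test function ψ in the place of `F`, the gauge yields equicontinuity of
the test distributions. -/
theorem kernelBound_sqrt : KernelBound fun r _ _ => √(1 + |r|) := by
  obtain ⟨C, hC0, hC⟩ := exists_dispersive_bound
  intro γ
  refine ⟨fun F => schwartzL1 F * schwartzSup γ +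
    C * (schwartzL1 F * schwartzSup (∂_{((0 : ℝ), (1 : ℝ))} γ) +
        schwartzL1 (∂_{((0 : ℝ), (1 : ℝ))} F) * schwartzSup γ), ?_, ?_, ?_⟩
  · have h1 := continuous_schwartzL1
    have h2 : Continuous fun F : 𝓢(ℝ × ℝ, ℂ) => schwartzL1 (∂_{((0 : ℝ), (1 : ℝ))} F) :=
      h1.comp (lineDerivOpCLM ℂ 𝓢(ℝ × ℝ, ℂ) ((0 : ℝ), (1 : ℝ))).continuous
    fun_prop
  · have : ∂_{((0 : ℝ), (1 : ℝ))} (0 : 𝓢(ℝ × ℝ, ℂ)) = 0 :=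
      (lineDerivOpCLM ℂ 𝓢(ℝ × ℝ, ℂ) ((0 : ℝ), (1 : ℝ))).map_zero
    simp [this, schwartzL1_zero]
  · intro F r x ω
    have hs : √(1 + |r|) ≤ 1 + √|r| := by
      rw [Real.sqrt_le_left (by positivity)]
      nlinarith [Real.sq_sqrt (abs_nonneg r), Real.sqrt_nonneg |r|]
    calc √(1 + |r|) * ‖chirpKernel F γ r x ω‖ ≤ (1 + √|r|) * ‖chirpKernel F γ r x ω‖ := by gcongr
      _ = ‖chirpKernel F γ r x ω‖ + √|r| * ‖chirpKernel F γ r x ω‖ := by ring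
      _ ≤ _ := add_le_add (norm_chirpKernel_le _ _ _ _ _) (hC _ _ _ _ _)

/-- Weights that may be multiplied to every weight with a kernel bound. -/
def IsKernelMultiplier (a : ℝ → ℝ × ℝ → ℝ × ℝ → ℝ) : Prop :=
  (∀ r x ω, 0 ≤ a r x ω) ∧ ∀ Θ : ℝ → ℝ × ℝ → ℝ × ℝ → ℝ, (∀ r x ω, 0 ≤ Θ r x ω) → KernelBound Θ →
    KernelBound fun r x ω => Θ r x ω * a r x ω

/-- The factor `a` is traded for operators acting on `F` or on `γ`. Those on `F` must be continuous,
because they are composed with the gauge; `B` may be arbitrary, because the gauge is chosen after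
the window. The slot `A'` serves `isKernelMultiplier_freq_snd` and is 0 elsewhere. -/
theorem isKernelMultiplier_one_add {a : ℝ → ℝ × ℝ → ℝ × ℝ → ℝ} (ha : ∀ r x ω, 0 ≤ a r x ω)
    (A A' : 𝓢(ℝ × ℝ, ℂ) →L[ℂ] 𝓢(ℝ × ℝ, ℂ)) (B : 𝓢(ℝ × ℝ, ℂ) → 𝓢(ℝ × ℝ, ℂ))
    (h : ∀ F γ r x ω, a r x ω * ‖chirpKernel F γ r x ω‖ ≤ ‖chirpKernel (A F) γ r x ω‖ +
      ‖chirpKernel F (B γ) r x ω‖ + ‖chirpKernel (A' F) γ r x ω‖) :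
    IsKernelMultiplier fun r x ω => 1 + a r x ω := by
  refine ⟨fun r x ω => add_nonneg zero_le_one (ha r x ω), fun Θ hΘ hb γ => ?_⟩
  obtain ⟨q, hq, hq0, hqb⟩ := hb γ
  obtain ⟨q', hq', hq0', hqb'⟩ := hb (B γ)
  refine ⟨fun F => q F + (q (A F) + q' F + q (A' F)), ?_, by simp [hq0, hq0'], ?_⟩
  · have h1 := hq.comp A.continuous
    have h2 := hq.comp A'.continuous
    simp only [Function.comp_def] at h1 h2
    fun_prop
  · intro F r x ω
    calc Θ r x ω * (1 + a r x ω) * ‖chirpKernel F γ r x ω‖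
        = Θ r x ω * ‖chirpKernel F γ r x ω‖ + Θ r x ω * (a r x ω * ‖chirpKernel F γ r x ω‖) := by ring
      _ ≤ Θ r x ω * ‖chirpKernel F γ r x ω‖ + Θ r x ω * (‖chirpKernel (A F) γ r x ω‖ +
          ‖chirpKernel F (B γ) r x ω‖ + ‖chirpKernel (A' F) γ r x ω‖) := by
        have := mul_le_mul_of_nonneg_left (h F γ r x ω) (hΘ r x ω)
        linarith
      _ ≤ _ := by
        rw [mul_add, mul_add]
        exact add_le_add (hqb _ _ _ _) (add_le_add (add_le_add (hqb _ _ _ _) (hqb' _ _ _ _))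
          (hqb _ _ _ _))

theorem chirpKernel_zero_left (γ : 𝓢(ℝ × ℝ, ℂ)) (r : ℝ) (x ω : ℝ × ℝ) :
    chirpKernel 0 γ r x ω = 0 := by simp [chirpKernel]

theorem isKernelMultiplier_fst : IsKernelMultiplier fun _ x _ => 1 + |x.1| := by
  refine isKernelMultiplier_one_add (fun _ _ _ => abs_nonneg _) mulFst 0 mulFst
    fun F γ r x ω => ?_
  have := fst_mul_chirpKernel F γ r x ω
  rw [← Real.norm_eq_abs, ← Complex.norm_real, ← norm_mul, this]
  simpa [chirpKernel_zero_left] using norm_sub_le _ _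

theorem isKernelMultiplier_snd : IsKernelMultiplier fun _ x _ => 1 + |x.2| := by
  refine isKernelMultiplier_one_add (fun _ _ _ => abs_nonneg _) mulSnd 0 mulSnd
    fun F γ r x ω => ?_
  have := snd_mul_chirpKernel F γ r x ω
  rw [← Real.norm_eq_abs, ← Complex.norm_real, ← norm_mul, this]
  simpa [chirpKernel_zero_left] using norm_sub_le _ _

theorem isKernelMultiplier_freq_fst : IsKernelMultiplier fun _ _ ω => 1 + |ω.1| := by
  refine isKernelMultiplier_one_add (fun _ _ _ => abs_nonneg _)
    (lineDerivOpCLM ℂ 𝓢(ℝ × ℝ, ℂ) ((1 : ℝ), (0 : ℝ))) 0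
    (lineDerivOpCLM ℂ 𝓢(ℝ × ℝ, ℂ) ((1 : ℝ), (0 : ℝ))) fun F γ r x ω => ?_
  have h := congrArg norm (freq_mul_chirpKernel F γ r x ω (1, 0))
  simp only [mul_one, mul_zero, add_zero, Complex.ofReal_zero, zero_mul] at h
  rw [norm_mul, norm_mul (ω.1 : ℂ), Complex.norm_real, Real.norm_eq_abs] at h
  have h2 : (1 : ℝ) ≤ ‖(2 * Real.pi * Complex.I : ℂ)‖ := by
    simp [abs_of_pos Real.pi_pos]
    linarith [Real.pi_gt_three]
  have h3 := norm_add_le (chirpKernel (∂_{((1 : ℝ), (0 : ℝ))} F) γ r x ω)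
    (chirpKernel F (∂_{((1 : ℝ), (0 : ℝ))} γ) r x ω)
  have h4 : |ω.1| * ‖chirpKernel F γ r x ω‖ ≤ ‖(2 * Real.pi * Complex.I : ℂ)‖ *
      (|ω.1| * ‖chirpKernel F γ r x ω‖) := le_mul_of_one_le_left (by positivity) h2
  simp only [zero_apply, chirpKernel_zero_left, norm_zero, add_zero]
  exact h4.trans (h.le.trans h3)

/-- The local frequency of the chirp is ω₂ + r u₂. Division by 1 + |r| turns the term r u₂ into a
bounded multiple of multiplication by u₂. -/
theorem isKernelMultiplier_freq_snd : IsKernelMultiplier fun r _ ω => 1 + |ω.2| / (1 + |r|) := by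
  refine isKernelMultiplier_one_add (fun _ _ _ => by positivity)
    (lineDerivOpCLM ℂ 𝓢(ℝ × ℝ, ℂ) ((0 : ℝ), (1 : ℝ))) mulSnd
    (lineDerivOpCLM ℂ 𝓢(ℝ × ℝ, ℂ) ((0 : ℝ), (1 : ℝ))) fun F γ r x ω => ?_
  have h := freq_mul_chirpKernel F γ r x ω (0, 1)
  simp only [mul_one, mul_zero, zero_add] at h
  set X := chirpKernel (∂_{((0 : ℝ), (1 : ℝ))} F) γ r x ω
  set Y := chirpKernel F (∂_{((0 : ℝ), (1 : ℝ))} γ) r x ω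
  set M := chirpKernel (mulSnd F) γ r x ω
  set K := chirpKernel F γ r x ω
  have hk0 : (2 * Real.pi * Complex.I : ℂ) ≠ 0 := Complex.two_pi_I_ne_zero
  have h2 : (1 : ℝ) ≤ ‖(2 * Real.pi * Complex.I : ℂ)‖ := by
    simp [abs_of_pos Real.pi_pos]
    linarith [Real.pi_gt_three]
  have h1 : (ω.2 : ℂ) * K = (2 * Real.pi * Complex.I)⁻¹ * (X + Y) - r * M := by
    rw [← h]; field_simp; ring
  have h3 : |ω.2| * ‖K‖ ≤ ‖X‖ + ‖Y‖ + |r| * ‖M‖ := by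
    rw [← Real.norm_eq_abs, ← Complex.norm_real, ← norm_mul, h1]
    refine (norm_sub_le _ _).trans ?_
    rw [norm_mul, norm_mul, norm_inv, Complex.norm_real, Real.norm_eq_abs]
    refine add_le_add ((mul_le_of_le_one_left (norm_nonneg _) (inv_le_one_of_one_le₀ h2)).trans
      (norm_add_le _ _)) le_rfl
  have hr : 0 < 1 + |r| := by positivity
  rw [div_mul_eq_mul_div, div_le_iff₀ hr]
  refine h3.trans ?_
  change _ ≤ (‖X‖ + ‖Y‖ + ‖M‖) * (1 + |r|)
  nlinarith [norm_nonneg X, norm_nonneg Y, norm_nonneg M, abs_nonneg r,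
    mul_nonneg (norm_nonneg X) (abs_nonneg r), mul_nonneg (norm_nonneg Y) (abs_nonneg r)]

theorem IsKernelMultiplier.pow {a : ℝ → ℝ × ℝ → ℝ × ℝ → ℝ} (ha : IsKernelMultiplier a) (N : ℕ) :
    IsKernelMultiplier fun r x ω => a r x ω ^ N := by
  refine ⟨fun r x ω => pow_nonneg (ha.1 r x ω) N, ?_⟩
  induction N with
  | zero => intro Θ _ hb; simpa using hb
  | succ N ih =>
    intro Θ hΘ hb
    have := ha.2 _ (fun r x ω => mul_nonneg (hΘ r x ω) (pow_nonneg (ha.1 r x ω) N)) (ih Θ hΘ hb)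
    simpa only [pow_succ, mul_assoc] using this

theorem IsKernelMultiplier.mul {a b : ℝ → ℝ × ℝ → ℝ × ℝ → ℝ} (ha : IsKernelMultiplier a)
    (hb : IsKernelMultiplier b) : IsKernelMultiplier fun r x ω => a r x ω * b r x ω := by
  refine ⟨fun r x ω => mul_nonneg (ha.1 r x ω) (hb.1 r x ω), fun Θ hΘ hbd => ?_⟩
  have := hb.2 _ (fun r x ω => mul_nonneg (hΘ r x ω) (ha.1 r x ω)) (ha.2 Θ hΘ hbd)
  simpa only [mul_assoc] using this

/-- Rapid decay of the chirped kernel, with the dispersive gain `(1 + |r|)^{-1/2}`. -/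
theorem kernelBound_decay (N : ℕ) : KernelBound fun r x ω => √(1 + |r|) *
    ((1 + |x.1|) ^ N * (1 + |x.2|) ^ N * ((1 + |ω.1|) ^ N * (1 + |ω.2| / (1 + |r|)) ^ N)) :=
  (((isKernelMultiplier_fst.pow N).mul (isKernelMultiplier_snd.pow N)).mul
    ((isKernelMultiplier_freq_fst.pow N).mul (isKernelMultiplier_freq_snd.pow N))).2 _
    (fun _ _ _ => Real.sqrt_nonneg _) kernelBound_sqrt

/-! ### Asymptotics of the chirped kernel -/

theorem tendsto_fresnel_scaled (a : ℝ) :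
    Tendsto (fun n : ℕ => fresnel (√(n + 1) * a)) atTop (𝓝 ((Real.sign a : ℝ) * fresnelLim)) := by
  have hs : Tendsto (fun n : ℕ => √((n : ℝ) + 1)) atTop atTop :=
    Real.tendsto_sqrt_atTop.comp (tendsto_atTop_add_const_right _ _ tendsto_natCast_atTop_atTop)
  rcases lt_trichotomy a 0 with h | h | h
  · have := tendsto_fresnel_atBot.comp (hs.atTop_mul_const_of_neg h)
    simpa [Function.comp_def, Real.sign_of_neg h] using this
  · subst h
    simp [fresnel]
  · have := tendsto_fresnel_atTop.comp (hs.atTop_mul_const h)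
    simpa [Function.comp_def, Real.sign_of_pos h] using this

theorem integral_deriv_mul_sign {b b' : ℝ → ℂ} (τ : ℝ) (hd : ∀ t, HasDerivAt b (b' t) t)
    (hi : Integrable b') (h1 : Tendsto b atTop (𝓝 0)) (h2 : Tendsto b atBot (𝓝 0)) :
    ∫ t, b' t * (Real.sign (t + τ) : ℝ) = -2 * b (-τ) := by
  have hi' : Integrable fun t => b' t * (Real.sign (t + τ) : ℝ) := by
    refine hi.mul_bdd (c := 1) ?_ ?_
    · have : Measurable Real.sign := by
        unfold Real.sign
        exact Measurable.ite measurableSet_Iio measurable_const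
          (Measurable.ite measurableSet_Ioi measurable_const measurable_const)
      exact (Complex.measurable_ofReal.comp (this.comp (measurable_id.add_const τ))).aestronglyMeasurable
    · filter_upwards with t
      rw [Complex.norm_real]
      rcases Real.sign_apply_eq (t + τ) with h | h | h <;> simp [h]
  rw [← intervalIntegral.integral_Iic_add_Ioi (b := -τ) hi'.integrableOn hi'.integrableOn]
  have e1 : ∫ t in Set.Ioi (-τ), b' t * (Real.sign (t + τ) : ℝ) = ∫ t in Set.Ioi (-τ), b' t := by
    refine setIntegral_congr_fun measurableSet_Ioi fun t ht => ?_
    have ht' : -τ < t := ht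
    simp [Real.sign_of_pos (show 0 < t + τ by linarith)]
  have e2 : ∫ t in Set.Iic (-τ), b' t * (Real.sign (t + τ) : ℝ) = ∫ t in Set.Iic (-τ), -b' t := by
    rw [integral_Iic_eq_integral_Iio, integral_Iic_eq_integral_Iio]
    refine setIntegral_congr_fun measurableSet_Iio fun t ht => ?_
    have ht' : t < -τ := ht
    simp [Real.sign_of_neg (show t + τ < 0 by linarith)]
  rw [e1, e2, integral_neg,
    integral_Ioi_of_hasDerivAt_of_tendsto' (fun t _ => hd t) hi.integrableOn h1,
    integral_Iic_of_hasDerivAt_of_tendsto' (fun t _ => hd t) hi.integrableOn h2]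
  ring

theorem tendsto_schwartz_vertical (B : 𝓢(ℝ × ℝ, ℂ)) (s : ℝ) :
    Tendsto (fun t : ℝ => B (s, t)) (cocompact ℝ) (𝓝 0) := by
  have h1 : Tendsto B (cocompact (ℝ × ℝ)) (𝓝 0) := B.toZeroAtInfty.zero_at_infty'
  refine h1.comp ?_
  have hs : Isometry fun t : ℝ => (s, t) := Isometry.of_dist_eq fun a b => by simp [Prod.dist_eq]
  exact hs.isClosedEmbedding.tendsto_cocompact

theorem integral_lineDeriv_mul_sign (B : 𝓢(ℝ × ℝ, ℂ)) (τ : ℝ) :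
    ∫ u : ℝ × ℝ, ∂_{((0 : ℝ), (1 : ℝ))} B u * (Real.sign (u.2 + τ) : ℝ) =
      -2 * ∫ s : ℝ, B (s, -τ) := by
  set B' := ∂_{((0 : ℝ), (1 : ℝ))} B with hB'
  have hi : Integrable fun u : ℝ × ℝ => B' u * (Real.sign (u.2 + τ) : ℝ) := by
    refine B'.integrable.mul_bdd (c := 1) ?_ ?_
    · have : Measurable Real.sign := by
        unfold Real.sign
        exact Measurable.ite measurableSet_Iio measurable_const
          (Measurable.ite measurableSet_Ioi measurable_const measurable_const)
      exact (Complex.measurable_ofReal.comp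
        (this.comp (measurable_snd.add_const τ))).aestronglyMeasurable
    · filter_upwards with t
      rw [Complex.norm_real]
      rcases Real.sign_apply_eq (t.2 + τ) with h | h | h <;> simp [h]
  have h0 := (Measure.volume_eq_prod ℝ ℝ)
  have hB'i : Integrable B' ((volume : Measure ℝ).prod volume) := by
    rw [← h0]; exact B'.integrable
  rw [h0] at hi ⊢
  rw [integral_prod _ hi, ← integral_const_mul]
  refine integral_congr_ae ?_
  filter_upwards [hB'i.prod_right_ae] with s hs
  refine integral_deriv_mul_sign (b := fun t => B (s, t)) (b' := fun t => B' (s, t)) τ ?_ hs ?_ ?_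
  · intro t
    have h := (B.hasFDerivAt (s, t)).comp_hasDerivAt t
      ((hasDerivAt_const t s).prodMk (hasDerivAt_id t))
    exact h.congr_deriv (by rw [hB', lineDerivOp_apply_eq_fderiv])
  · exact (tendsto_schwartz_vertical B s).mono_left atTop_le_cocompact
  · exact (tendsto_schwartz_vertical B s).mono_left atBot_le_cocompact

/-- Stationary phase for the vertical chirp. -/
theorem tendsto_sqrt_mul_integral_chirp (B : 𝓢(ℝ × ℝ, ℂ)) (τ : ℝ) :
    Tendsto (fun n : ℕ => (√(n + 1) : ℂ) *
      ∫ u : ℝ × ℝ, B u * phaseExp (-((n + 1) / 2 * (u.2 + τ) ^ 2))) atTop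
      (𝓝 (2 * fresnelLim * ∫ s : ℝ, B (s, -τ))) := by
  obtain ⟨C, hC0, hC⟩ := exists_norm_fresnel_le
  set v : ℝ × ℝ := (0, 1) with hv
  have hcont : ∀ n : ℕ, Continuous fun u : ℝ × ℝ => fresnel (√(n + 1) * (u.2 + τ)) := fun n =>
    continuous_fresnel.comp (by fun_prop)
  -- The scaled chirp is the u₂-derivative of a bounded Fresnel function, so the derivative can be
  -- moved to `B`. The Fresnel function converges to a multiple of sign(u₂ + τ), whose jump singles
  -- out the line u₂ = -τ.
  have hstep : ∀ n : ℕ, (√(n + 1) : ℂ) *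
      ∫ u : ℝ × ℝ, B u * phaseExp (-((n + 1) / 2 * (u.2 + τ) ^ 2)) =
      -∫ u : ℝ × ℝ, ∂_{v} B u * fresnel (√(n + 1) * (u.2 + τ)) := by
    intro n
    have hR : (0 : ℝ) ≤ (n : ℝ) + 1 := by positivity
    rw [← integral_schwartz_mul_lineDeriv B
      (h := fun u : ℝ × ℝ => fresnel (√(n + 1) * (u.2 + τ)))
      (h' := fun u : ℝ × ℝ => √(n + 1) * phaseExp (-((n + 1) / 2 * (u.2 + τ) ^ 2))) (C := C)
      ?_ (hcont n) (fun u => hC _) ?_]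
    · rw [← integral_const_mul]
      congr 1
      funext u
      ring
    · intro u
      have e2 : HasDerivAt (fun t : ℝ => √((n : ℝ) + 1) * (u.2 + t + τ)) (√((n : ℝ) + 1)) 0 := by
        simpa using (((hasDerivAt_id (0 : ℝ)).const_add u.2).add_const τ).const_mul (√((n : ℝ) + 1))
      have e3 := (hasDerivAt_fresnel _).scomp (0 : ℝ) e2
      have e5 : (fun t : ℝ => fresnel (√(n + 1) * ((u + t • v).2 + τ))) =
          fresnel ∘ fun t => √((n : ℝ) + 1) * (u.2 + t + τ) := by
        funext t; simp [hv]
      rw [HasLineDerivAt, e5]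
      refine e3.congr_deriv ?_
      rw [add_zero, mul_pow, Real.sq_sqrt hR]
      simp only [Complex.real_smul]
      congr 2
      ring
    · refine integrable_schwartz_mul B (C := √((n : ℝ) + 1)) (by fun_prop) fun u => ?_
      rw [norm_mul, norm_phaseExp, Complex.norm_real]
      simp [abs_of_nonneg]
  simp_rw [hstep]
  have hdct : Tendsto (fun n : ℕ => ∫ u : ℝ × ℝ, ∂_{v} B u * fresnel (√(n + 1) * (u.2 + τ))) atTop
      (𝓝 (∫ u : ℝ × ℝ, ∂_{v} B u * ((Real.sign (u.2 + τ) : ℝ) * fresnelLim))) := by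
    refine tendsto_integral_of_dominated_convergence (fun u => ‖∂_{v} B u‖ * C) ?_
      ((∂_{v} B).integrable.norm.mul_const C) ?_ ?_
    · intro n
      exact ((∂_{v} B).continuous.mul (hcont n)).aestronglyMeasurable
    · intro n
      filter_upwards with u
      rw [norm_mul]
      gcongr
      exact hC _
    · filter_upwards with u
      exact (tendsto_fresnel_scaled (u.2 + τ)).const_mul _
  have hval : ∫ u : ℝ × ℝ, ∂_{v} B u * ((Real.sign (u.2 + τ) : ℝ) * fresnelLim) =
      -(2 * fresnelLim * ∫ s : ℝ, B (s, -τ)) := by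
    simp_rw [← mul_assoc]
    rw [integral_mul_const, integral_lineDeriv_mul_sign]
    ring
  rw [hval] at hdct
  simpa using hdct.neg

/-- The phase `u ↦ R u₁ + η u₂ + r u₂² / 2`. -/
def quadPhase (R η r : ℝ) (u : ℝ × ℝ) : ℝ := R * u.1 + η * u.2 + r / 2 * u.2 ^ 2

theorem hasTemperateGrowth_quadPhase (R η r : ℝ) : (quadPhase R η r).HasTemperateGrowth :=
  (((Function.HasTemperateGrowth.const R).mul hasTemperateGrowth_fst).add
    ((Function.HasTemperateGrowth.const η).mul hasTemperateGrowth_snd)).add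
    ((Function.HasTemperateGrowth.const (r / 2)).mul (hasTemperateGrowth_snd.pow 2))

/-- The Schwartz function `e^{2π i (R u₁ + η u₂ + r u₂² / 2)} G(u)`. -/
def chirpMul (R η r : ℝ) (G : 𝓢(ℝ × ℝ, ℂ)) : 𝓢(ℝ × ℝ, ℂ) := phaseShift (quadPhase R η r) 0 G

theorem chirpMul_apply (R η r : ℝ) (G : 𝓢(ℝ × ℝ, ℂ)) (u : ℝ × ℝ) :
    chirpMul R η r G u = phaseExp (quadPhase R η r u) * G u := by
  rw [chirpMul, phaseShift_apply (hasTemperateGrowth_quadPhase R η r), sub_zero]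
  rfl

/-- The restriction to a horizontal line of the chirped kernel. -/
def sliceKernel (F γ : 𝓢(ℝ × ℝ, ℂ)) (x : ℝ × ℝ) (ω t : ℝ) : ℂ :=
  ∫ s : ℝ, F (s, t) * (starRingEnd ℂ) (γ ((s, t) - x)) * phaseExp (-(ω * s))

theorem exists_norm_schwartz_le_inv (F : 𝓢(ℝ × ℝ, ℂ)) :
    ∃ C : ℝ, 0 ≤ C ∧ ∀ s t : ℝ, ‖F (s, t)‖ ≤ C * (1 + s ^ 2)⁻¹ := by
  have h := fun u => one_add_le_sup_seminorm_apply (𝕜 := ℝ) (m := (2, 0)) le_rfl le_rfl F u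
  set C := 2 ^ 2 * ((Finset.Iic (2, 0)).sup fun m => SchwartzMap.seminorm ℝ m.1 m.2) F with hC
  have hC0 : 0 ≤ C := by positivity
  refine ⟨C, hC0, fun s t => ?_⟩
  have h1 := h (s, t)
  simp only [norm_iteratedFDeriv_zero] at h1
  rw [← div_eq_mul_inv, le_div_iff₀ (by positivity)]
  refine le_trans ?_ h1
  rw [mul_comm]
  gcongr
  have h2 : |s| ≤ ‖(s, t)‖ := norm_fst_le (s, t)
  have h3 := sq_abs s
  nlinarith [abs_nonneg s, norm_nonneg (s, t)]

theorem continuous_sliceKernel (F γ : 𝓢(ℝ × ℝ, ℂ)) :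
    Continuous fun z : (ℝ × ℝ) × (ℝ × ℝ) => sliceKernel F γ z.1 z.2.1 z.2.2 := by
  have hF := F.continuous
  have hγ := γ.continuous
  obtain ⟨C, hC0, hC⟩ := exists_norm_schwartz_le_inv F
  refine continuous_of_dominated (bound := fun s => C * (1 + s ^ 2)⁻¹ * schwartzSup γ) ?_ ?_
    ((integrable_inv_one_add_sq.const_mul C).mul_const _) ?_
  · intro z
    apply Continuous.aestronglyMeasurable
    fun_prop
  · intro z
    filter_upwards with s
    rw [mul_assoc, norm_mul]
    exact mul_le_mul (hC s _) (norm_chirpKernel_integrand γ _ _ _) (norm_nonneg _) (by positivity)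
  · filter_upwards with s
    fun_prop

/-- With equal windows and zero shifts the slice is ∫ |γ(s,t)|² ds. -/
theorem exists_sliceKernel_ne_zero {γ : 𝓢(ℝ × ℝ, ℂ)} (hγ : γ ≠ 0) :
    ∃ t, sliceKernel γ γ 0 0 t ≠ 0 := by
  obtain ⟨⟨a, t⟩, ha⟩ : ∃ u, γ u ≠ 0 := by
    by_contra! h
    exact hγ (SchwartzMap.ext h)
  refine ⟨t, fun h => ?_⟩
  have hc := γ.continuous
  have e : sliceKernel γ γ 0 0 t = ((∫ s : ℝ, ‖γ (s, t)‖ ^ 2 : ℝ) : ℂ) := by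
    rw [sliceKernel, ← integral_complex_ofReal]
    congr 1
    funext s
    simp only [sub_zero, zero_mul, neg_zero, phaseExp_zero, mul_one, Complex.mul_conj']
    push_cast
    rfl
  rw [e, Complex.ofReal_eq_zero] at h
  obtain ⟨C, hC0, hC⟩ := exists_norm_schwartz_le_inv γ
  have hi : Integrable fun s : ℝ => ‖γ (s, t)‖ ^ 2 := by
    refine ((integrable_inv_one_add_sq.const_mul C).mul_const (schwartzSup γ)).mono'
      (by apply Continuous.aestronglyMeasurable; fun_prop) ?_
    filter_upwards with s
    rw [Real.norm_of_nonneg (by positivity), sq]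
    exact mul_le_mul (hC s t) (norm_le_schwartzSup _ _) (norm_nonneg _) (by positivity)
  have hpos : 0 < ∫ s : ℝ, ‖γ (s, t)‖ ^ 2 := by
    refine integral_pos_of_integrable_nonneg_nonzero (x := a) (by fun_prop) hi
      (fun s => by positivity) ?_
    simpa using ha
  linarith

/-- Scaling ω₂ as (n + 1)τ keeps the stationary line u₂ = -τ fixed. The bounded offset `r` of the
rate is absorbed into the amplitude and contributes only a unimodular factor on that line. -/
theorem tendsto_chirpKernel (F γ : 𝓢(ℝ × ℝ, ℂ)) (x : ℝ × ℝ) (ω r τ : ℝ) :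
    Tendsto (fun n : ℕ => √(n + 1) * ‖chirpKernel F γ (n + 1 + r) x (ω, (n + 1) * τ)‖) atTop
      (𝓝 (2 * ‖fresnelLim‖ * ‖sliceKernel F γ x ω (-τ)‖)) := by
  set Γ : 𝓢(ℝ × ℝ, ℂ) := schwartzConj (compSubConstCLM ℂ x γ) with hΓ
  set B : 𝓢(ℝ × ℝ, ℂ) := smulLeftCLM ℂ Γ (chirpMul (-ω) 0 (-r) F) with hB
  have hBu : ∀ u, B u = (starRingEnd ℂ) (γ (u - x)) * (phaseExp (quadPhase (-ω) 0 (-r) u) * F u) := by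
    intro u
    rw [hB, smulLeftCLM_apply_apply Γ.hasTemperateGrowth, chirpMul_apply, hΓ, schwartzConj_apply]
    simp
  have h := (tendsto_sqrt_mul_integral_chirp B τ).norm
  have e1 : ‖2 * fresnelLim * ∫ s : ℝ, B (s, -τ)‖ =
      2 * ‖fresnelLim‖ * ‖sliceKernel F γ x ω (-τ)‖ := by
    have : ∫ s : ℝ, B (s, -τ) = phaseExp (-(r / 2 * τ ^ 2)) * sliceKernel F γ x ω (-τ) := by
      rw [sliceKernel, ← integral_const_mul]
      congr 1
      funext s
      rw [hBu, show quadPhase (-ω) 0 (-r) (s, -τ) = -(r / 2 * τ ^ 2) + -(ω * s) by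
        simp only [quadPhase]; ring, phaseExp_add]
      ring
    rw [this, norm_mul, norm_mul, norm_mul, norm_phaseExp, one_mul]
    simp
  rw [e1] at h
  refine h.congr fun n => ?_
  rw [norm_mul, Complex.norm_real, Real.norm_of_nonneg (Real.sqrt_nonneg _)]
  congr 1
  have : chirpKernel F γ (n + 1 + r) x (ω, (n + 1) * τ) = phaseExp ((n + 1) / 2 * τ ^ 2) *
      ∫ u : ℝ × ℝ, B u * phaseExp (-((n + 1) / 2 * (u.2 + τ) ^ 2)) := by
    rw [chirpKernel, ← integral_const_mul]
    congr 1
    funext u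
    rw [hBu, show -((ω, ((n : ℝ) + 1) * τ).1 * u.1 + (ω, ((n : ℝ) + 1) * τ).2 * u.2 +
      ((n : ℝ) + 1 + r) / 2 * u.2 ^ 2) = ((n : ℝ) + 1) / 2 * τ ^ 2 + quadPhase (-ω) 0 (-r) u +
        -(((n : ℝ) + 1) / 2 * (u.2 + τ) ^ 2) by simp only [quadPhase]; ring, phaseExp_add, phaseExp_add]
    ring
  rw [this, norm_mul, norm_phaseExp, one_mul]

theorem norm_chirpKernel_conj (F γ : 𝓢(ℝ × ℝ, ℂ)) (r : ℝ) (x ω : ℝ × ℝ) :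
    ‖chirpKernel (schwartzConj F) (schwartzConj γ) (-r) x (-ω)‖ = ‖chirpKernel F γ r x ω‖ := by
  rw [← RCLike.norm_conj (chirpKernel F γ r x ω), chirpKernel, chirpKernel, ← integral_conj]
  congr 2
  funext u
  simp only [schwartzConj_apply, map_mul, conj_phaseExp, Prod.fst_neg, Prod.snd_neg]
  congr 2
  ring

theorem norm_sliceKernel_conj (F γ : 𝓢(ℝ × ℝ, ℂ)) (x : ℝ × ℝ) (ω t : ℝ) :
    ‖sliceKernel (schwartzConj F) (schwartzConj γ) x (-ω) t‖ = ‖sliceKernel F γ x ω t‖ := by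
  rw [← RCLike.norm_conj (sliceKernel F γ x ω t), sliceKernel, sliceKernel, ← integral_conj]
  congr 2
  funext u
  simp only [schwartzConj_apply, map_mul, conj_phaseExp]
  congr 2
  ring

/-- Conjugation reverses the sign of the rate and of the frequency, which moves the stationary line
to u₂ = τ. -/
theorem tendsto_chirpKernel_neg (F γ : 𝓢(ℝ × ℝ, ℂ)) (x : ℝ × ℝ) (ω τ : ℝ) :
    Tendsto (fun n : ℕ => √(n + 1) * ‖chirpKernel F γ (-(n + 1)) x (ω, (n + 1) * τ)‖) atTop
      (𝓝 (2 * ‖fresnelLim‖ * ‖sliceKernel F γ x ω τ‖)) := by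
  have h := tendsto_chirpKernel (schwartzConj F) (schwartzConj γ) x (-ω) 0 (-τ)
  rw [neg_neg, norm_sliceKernel_conj] at h
  refine h.congr fun n => ?_
  rw [← norm_chirpKernel_conj F γ]
  simp

/-- Fatou's lemma, also for p = ∞: pointwise convergence suffices, and continuity of the limit makes
a single nonzero value give a positive norm. -/
theorem eventually_le_eLpNorm_of_tendsto {α : Type*} [TopologicalSpace α] [MeasurableSpace α]
    [BorelSpace α] {μ : Measure α} [μ.IsOpenPosMeasure] {p : ℝ≥0∞} (hp : p ≠ 0)
    {k : ℕ → α → ℝ} {l : α → ℝ} (hk : ∀ n, AEStronglyMeasurable (k n) μ) (hl : Continuous l)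
    (hlm : AEStronglyMeasurable l μ)
    (hlim : ∀ z, Tendsto (fun n => k n z) atTop (𝓝 (l z))) {z₀ : α} (h0 : l z₀ ≠ 0) :
    ∃ c : ℝ, 0 < c ∧ ∀ᶠ n in atTop, ENNReal.ofReal c ≤ eLpNorm (k n) p μ := by
  have hpos : 0 < eLpNorm l p μ := by
    rw [pos_iff_ne_zero]
    intro h
    rw [eLpNorm_eq_zero_iff hlm hp] at h
    have := (Continuous.ae_eq_iff_eq μ hl continuous_const).1 h
    exact h0 (congrFun this z₀)
  have hF := Lp.eLpNorm_lim_le_liminf_eLpNorm (p := p) hk l (ae_of_all _ hlim)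
  obtain ⟨c, hc0, hc⟩ := ENNReal.lt_iff_exists_nnreal_btwn.1 hpos
  refine ⟨c, by exact_mod_cast hc0, ?_⟩
  have := eventually_lt_of_lt_liminf (hc.trans_le hF)
  filter_upwards [this] with n hn
  rw [ENNReal.ofReal_coe_nnreal]
  exact hn.le

/-! ### Inclusions of coorbit-type spaces are bounded -/

section Superposition

variable {f : ℕ → 𝓢'(ℝ × ℝ, ℂ)} {q : 𝓢(ℝ × ℝ, ℂ) → ℝ}

theorem hasSum_norm_ellOne (c : lp (fun _ : ℕ => ℂ) 1) : HasSum (fun n => ‖c n‖) ‖c‖ := by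
  simpa using lp.hasSum_norm (p := 1) (by simp) c

theorem summable_superposition (hfq : ∀ n ψ, ‖f n ψ‖ ≤ q ψ) (c : lp (fun _ : ℕ => ℂ) 1)
    (ψ : 𝓢(ℝ × ℝ, ℂ)) : Summable fun n => c n * f n ψ := by
  refine Summable.of_norm_bounded ((hasSum_norm_ellOne c).mul_right (q ψ)).summable fun n => ?_
  rw [norm_mul]
  exact mul_le_mul_of_nonneg_left (hfq n ψ) (norm_nonneg _)

theorem norm_superposition_le (hfq : ∀ n ψ, ‖f n ψ‖ ≤ q ψ) (c : lp (fun _ : ℕ => ℂ) 1)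
    (ψ : 𝓢(ℝ × ℝ, ℂ)) : ‖∑' n, c n * f n ψ‖ ≤ ‖c‖ * q ψ := by
  refine tsum_of_norm_bounded ((hasSum_norm_ellOne c).mul_right (q ψ)) fun n => ?_
  rw [norm_mul]
  exact mul_le_mul_of_nonneg_left (hfq n ψ) (norm_nonneg _)

/-- The superposition `∑ cₙ fₙ` of an equicontinuous sequence of distributions. -/
def superposition (hq : Continuous q) (hq0 : q 0 = 0) (hfq : ∀ n ψ, ‖f n ψ‖ ≤ q ψ)
    (c : lp (fun _ : ℕ => ℂ) 1) : 𝓢'(ℝ × ℝ, ℂ) :=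
  ContinuousLinearMap.toPointwiseConvergenceCLM _ _ _ _
    { toFun := fun ψ => ∑' n, c n * f n ψ
      map_add' := fun ψ χ => by
        simp only [map_add, mul_add]
        exact (summable_superposition hfq c ψ).tsum_add (summable_superposition hfq c χ)
      map_smul' := fun a ψ => by
        simp only [map_smul, smul_eq_mul, RingHom.id_apply, mul_left_comm _ a]
        exact tsum_mul_left
      cont := by
        let L : 𝓢(ℝ × ℝ, ℂ) →+ ℂ :=
          { toFun := fun ψ => ∑' n, c n * f n ψ
            map_zero' := by simp
            map_add' := fun ψ χ => by
              simp only [map_add, mul_add]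
              exact (summable_superposition hfq c ψ).tsum_add (summable_superposition hfq c χ) }
        refine continuous_of_continuousAt_zero L ?_
        rw [ContinuousAt, map_zero]
        refine squeeze_zero_norm (fun ψ => norm_superposition_le hfq c ψ) ?_
        have h := (hq.tendsto 0).const_mul ‖c‖
        rwa [hq0, mul_zero] at h }

theorem superposition_apply (hq : Continuous q) (hq0 : q 0 = 0) (hfq : ∀ n ψ, ‖f n ψ‖ ≤ q ψ)
    (c : lp (fun _ : ℕ => ℂ) 1) (ψ : 𝓢(ℝ × ℝ, ℂ)) :
    superposition hq hq0 hfq c ψ = ∑' n, c n * f n ψ := rfl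

theorem tendsto_partial_superposition {α : Type*} {φA : α → 𝓢(ℝ × ℝ, ℂ)} {wA : α → ℂ} (hq : Continuous q) (hq0 : q 0 = 0)
    (hfq : ∀ n ψ, ‖f n ψ‖ ≤ q ψ) (c : lp (fun _ : ℕ => ℂ) 1) (z : α) :
    Tendsto (fun N : ℕ => (∑ n ∈ Finset.range N, fun z => c n * (f n (φA z) * wA z)) z) atTop
      (𝓝 (superposition hq hq0 hfq c (φA z) * wA z)) := by
  have h := ((summable_superposition hfq c (φA z)).hasSum.mul_right (wA z)).tendsto_sum_nat
  simpa [Finset.sum_apply, mul_assoc, superposition_apply] using h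

variable {α β : Type*} [MeasurableSpace α] [MeasurableSpace β] {μ : Measure α} {ν : Measure β}
  {p : ℝ≥0∞} {φA : α → 𝓢(ℝ × ℝ, ℂ)} {wA : α → ℂ} {φB : β → 𝓢(ℝ × ℝ, ℂ)} {wB : β → ℂ}

theorem aestronglyMeasurable_superposition (hq : Continuous q) (hq0 : q 0 = 0)
    (hfq : ∀ n ψ, ‖f n ψ‖ ≤ q ψ)
    (hm : ∀ n, AEStronglyMeasurable (fun z => f n (φA z) * wA z) μ) (c : lp (fun _ : ℕ => ℂ) 1) :
    AEStronglyMeasurable (fun z => superposition hq hq0 hfq c (φA z) * wA z) μ :=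
  aestronglyMeasurable_of_tendsto_ae atTop
    (fun _ => Finset.aestronglyMeasurable_sum _ fun n _ => (hm n).const_mul _)
    (ae_of_all _ (tendsto_partial_superposition hq hq0 hfq c))

theorem memLp_superposition (hp : 1 ≤ p) (hq : Continuous q) (hq0 : q 0 = 0)
    (hfq : ∀ n ψ, ‖f n ψ‖ ≤ q ψ)
    (hm : ∀ n, AEStronglyMeasurable (fun z => f n (φA z) * wA z) μ) {C : ℝ}
    (hC : ∀ n, eLpNorm (fun z => f n (φA z) * wA z) p μ ≤ ENNReal.ofReal C)
    (c : lp (fun _ : ℕ => ℂ) 1) :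
    MemLp (fun z => superposition hq hq0 hfq c (φA z) * wA z) p μ := by
  refine ⟨aestronglyMeasurable_superposition hq hq0 hfq hm c, ?_⟩
  refine lt_of_le_of_lt (Lp.eLpNorm_le_of_ae_tendsto
    (C := ENNReal.ofReal ‖c‖ * ENNReal.ofReal C) (Eventually.of_forall fun N => ?_)
    (fun N => Finset.aestronglyMeasurable_sum _ fun n _ => (hm n).const_mul _)
    (ae_of_all _ (tendsto_partial_superposition hq hq0 hfq c)))
    (ENNReal.mul_lt_top ENNReal.ofReal_lt_top ENNReal.ofReal_lt_top)
  refine (eLpNorm_sum_le (fun n _ => (hm n).const_mul _) hp).trans ?_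
  calc ∑ n ∈ Finset.range N, eLpNorm (fun z => c n * (f n (φA z) * wA z)) p μ
      ≤ ∑ n ∈ Finset.range N, ENNReal.ofReal ‖c n‖ * ENNReal.ofReal C := by
        refine Finset.sum_le_sum fun n _ => ?_
        have : eLpNorm (fun z => c n * (f n (φA z) * wA z)) p μ =
            ‖c n‖ₑ * eLpNorm (fun z => f n (φA z) * wA z) p μ :=
          eLpNorm_const_smul (c n) (fun z => f n (φA z) * wA z) p μ
        rw [this, ofReal_norm]
        gcongr
        exact hC n
    _ = ENNReal.ofReal (∑ n ∈ Finset.range N, ‖c n‖) * ENNReal.ofReal C := by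
        rw [← Finset.sum_mul, ENNReal.ofReal_sum_of_nonneg fun n _ => norm_nonneg _]
    _ ≤ _ := by
        gcongr
        exact sum_le_hasSum _ (fun n _ => norm_nonneg _) (hasSum_norm_ellOne c)

/-- A uniform boundedness argument on ℓ¹, which avoids completeness of the coorbit-type spaces.
Every superposition ∑ cₙ fₙ lies in the first space, hence in the second, so its second norm is a
finite seminorm of c. It is lower semicontinuous by Fatou, hence continuous because ℓ¹ is a Banach
space, and the unit vectors give back the fₙ. -/
theorem exists_bound_sequence_of_inclusion (hp : 1 ≤ p)
    (hsub : ∀ f : 𝓢'(ℝ × ℝ, ℂ), MemLp (fun z => f (φA z) * wA z) p μ →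
      MemLp (fun z => f (φB z) * wB z) p ν)
    (hq : Continuous q) (hq0 : q 0 = 0) (hfq : ∀ n ψ, ‖f n ψ‖ ≤ q ψ)
    (hmA : ∀ n, AEStronglyMeasurable (fun z => f n (φA z) * wA z) μ)
    (hmB : ∀ n, AEStronglyMeasurable (fun z => f n (φB z) * wB z) ν) {C : ℝ}
    (hC : ∀ n, eLpNorm (fun z => f n (φA z) * wA z) p μ ≤ ENNReal.ofReal C) :
    ∃ D : ℝ, ∀ n, eLpNorm (fun z => f n (φB z) * wB z) p ν ≤ ENNReal.ofReal D := by
  set T := superposition hq hq0 hfq with hT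
  have hfin : ∀ c, eLpNorm (fun z => T c (φB z) * wB z) p ν ≠ ∞ := fun c =>
    (hsub _ (memLp_superposition hp hq hq0 hfq hmA hC c)).2.ne
  have hmT := aestronglyMeasurable_superposition hq hq0 hfq hmB
  have hTadd : ∀ c d ψ, T (c + d) ψ = T c ψ + T d ψ := by
    intro c d ψ
    simp only [hT, superposition_apply, lp.coeFn_add, Pi.add_apply, add_mul]
    exact (summable_superposition hfq c ψ).tsum_add (summable_superposition hfq d ψ)
  have hTsmul : ∀ (a : ℂ) c ψ, T (a • c) ψ = a * T c ψ := by
    intro a c ψ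
    simp only [hT, superposition_apply, lp.coeFn_smul, Pi.smul_apply, smul_eq_mul, mul_assoc]
    exact tsum_mul_left
  let P : Seminorm ℂ (lp (fun _ : ℕ => ℂ) 1) :=
    Seminorm.of (fun c => (eLpNorm (fun z => T c (φB z) * wB z) p ν).toReal)
      (fun c d => by
        rw [← ENNReal.toReal_add (hfin c) (hfin d)]
        refine ENNReal.toReal_mono (ENNReal.add_ne_top.2 ⟨hfin c, hfin d⟩) ?_
        refine le_trans (le_of_eq ?_) (eLpNorm_add_le (hmT c) (hmT d) hp)
        congr 1
        funext z
        change T (c + d) (φB z) * wB z = T c (φB z) * wB z + T d (φB z) * wB z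
        rw [hTadd, add_mul])
      (fun a c => by
        have : eLpNorm (fun z => T (a • c) (φB z) * wB z) p ν =
            ‖a‖ₑ * eLpNorm (fun z => T c (φB z) * wB z) p ν := by
          rw [← eLpNorm_const_smul]
          congr 1
          funext z
          simp [hTsmul, mul_assoc]
        rw [this, ENNReal.toReal_mul, toReal_enorm])
  have hPdef : ∀ c, P c = (eLpNorm (fun z => T c (φB z) * wB z) p ν).toReal := fun c => rfl
  have hlsc : LowerSemicontinuous P := by
    rw [lowerSemicontinuous_iff_isClosed_preimage]
    intro y
    refine IsSeqClosed.isClosed fun cs c hcs hlim => ?_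
    simp only [Set.mem_preimage, Set.mem_Iic] at hcs ⊢
    have hy : 0 ≤ y := (apply_nonneg P (cs 0)).trans (hcs 0)
    rw [hPdef]
    refine ENNReal.toReal_le_of_le_ofReal hy ?_
    refine Lp.eLpNorm_le_of_ae_tendsto (u := atTop) (f := fun k z => T (cs k) (φB z) * wB z)
      (Eventually.of_forall fun k => ?_) (fun k => hmT (cs k)) (ae_of_all _ fun z => ?_)
    · rw [← ENNReal.ofReal_toReal (hfin (cs k))]
      exact ENNReal.ofReal_le_ofReal (hcs k)
    -- Convergence in ℓ¹ gives pointwise convergence of the transforms, since each evaluation is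
    -- bounded on ℓ¹ by the gauge.
    · refine Tendsto.mul_const _ ?_
      rw [tendsto_iff_norm_sub_tendsto_zero]
      have h1 : Tendsto (fun k => ‖cs k - c‖ * q (φB z)) atTop (𝓝 0) := by
        have := (tendsto_iff_norm_sub_tendsto_zero.1 hlim).mul_const (q (φB z))
        simpa using this
      refine squeeze_zero (fun _ => norm_nonneg _) (fun k => ?_) h1
      have h2 : T (cs k) (φB z) - T c (φB z) = T (cs k - c) (φB z) := by
        have := hTadd (cs k - c) c (φB z)
        rw [sub_add_cancel] at this
        rw [this]; ring
      rw [h2]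
      exact norm_superposition_le hfq _ _
  have hcont := P.continuous_of_lowerSemicontinuous hlsc
  obtain ⟨D, _, hD⟩ := P.bound_of_continuous_normedSpace hcont
  refine ⟨D, fun n => ?_⟩
  have h1 := hD (lp.single 1 n 1)
  rw [lp.norm_single (by simp), norm_one, mul_one, hPdef] at h1
  have h2 : ∀ ψ, T (lp.single 1 n 1) ψ = f n ψ := by
    intro ψ
    rw [hT, superposition_apply, tsum_eq_single n]
    · simp
    · intro k hk
      simp [hk]
  have h3 := hfin (lp.single 1 n 1)
  simp only [h2] at h1 h3
  rw [← ENNReal.ofReal_toReal h3]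
  exact ENNReal.ofReal_le_ofReal h1

theorem eLpNorm_smul_distribution (a : ℂ) (f : 𝓢'(ℝ × ℝ, ℂ)) :
    eLpNorm (fun z => (a • f) (φA z) * wA z) p μ =
      ‖a‖ₑ * eLpNorm (fun z => f (φA z) * wA z) p μ := by
  rw [← eLpNorm_const_smul]
  congr 1
  funext z
  simp [mul_assoc]

/-- If one coorbit-type space is contained in another, then on every family of distributions that
is suitably equicontinuous the norm of the second is dominated by that of the first. -/
theorem exists_bound_of_inclusion (hp : 1 ≤ p)
    (hsub : ∀ f : 𝓢'(ℝ × ℝ, ℂ), MemLp (fun z => f (φA z) * wA z) p μ →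
      MemLp (fun z => f (φB z) * wB z) p ν)
    {ι : Type*} {f : ι → 𝓢'(ℝ × ℝ, ℂ)} {w : ι → ℝ} (hw : ∀ i, 0 < w i)
    (hq : Continuous q) (hq0 : q 0 = 0) (hfq : ∀ i ψ, ‖f i ψ‖ ≤ w i * q ψ)
    (hmA : ∀ i, AEStronglyMeasurable (fun z => f i (φA z) * wA z) μ)
    (hmB : ∀ i, AEStronglyMeasurable (fun z => f i (φB z) * wB z) ν) {C : ℝ}
    (hC : ∀ i, eLpNorm (fun z => f i (φA z) * wA z) p μ ≤ ENNReal.ofReal (C * w i)) :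
    ∃ D : ℝ, 0 < D ∧ ∀ i, eLpNorm (fun z => f i (φB z) * wB z) p ν ≤ ENNReal.ofReal (D * w i) := by
  by_contra! hcon
  choose i hi using fun n : ℕ => hcon (n + 1) (by positivity)
  have hwc : ∀ n, ‖((w (i n))⁻¹ : ℂ)‖ = (w (i n))⁻¹ := fun n => by
    rw [norm_inv, Complex.norm_real, Real.norm_of_nonneg (hw _).le]
  -- Division by the weights `w` makes the chosen counterexamples equicontinuous and bounded in the
  -- first norm, so the sequential version contradicts their growth in the second.
  have key : ∃ D : ℝ, ∀ n, eLpNorm (fun z => (((w (i n))⁻¹ : ℂ) • f (i n)) (φB z) * wB z) p ν ≤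
      ENNReal.ofReal D := by
    refine exists_bound_sequence_of_inclusion hp hsub
      (f := fun n => ((w (i n))⁻¹ : ℂ) • f (i n)) hq hq0 (C := C) ?_ ?_ ?_ ?_
    · intro n ψ
      have h1 := hfq (i n) ψ
      change ‖((w (i n))⁻¹ : ℂ) * f (i n) ψ‖ ≤ q ψ
      rw [norm_mul, hwc, inv_mul_le_iff₀ (hw _)]
      exact h1
    · intro n
      have := (hmA (i n)).const_mul ((w (i n))⁻¹ : ℂ)
      simpa [mul_assoc] using this
    · intro n
      have := (hmB (i n)).const_mul ((w (i n))⁻¹ : ℂ)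
      simpa [mul_assoc] using this
    · intro n
      rw [eLpNorm_smul_distribution, ← ofReal_norm, hwc]
      have hwn := hw (i n)
      refine (mul_le_mul_right (hC (i n)) _).trans ?_
      rw [← ENNReal.ofReal_mul (by positivity)]
      refine ENNReal.ofReal_le_ofReal (le_of_eq ?_)
      field_simp
  obtain ⟨D, hD⟩ := key
  obtain ⟨n, hn⟩ := exists_nat_ge D
  have h1 := hi n
  have h2 := hD n
  rw [eLpNorm_smul_distribution, ← ofReal_norm, hwc] at h2
  have hwn := hw (i n)
  have h3 : ENNReal.ofReal (w (i n)) * (ENNReal.ofReal (w (i n))⁻¹ *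
      eLpNorm (fun z => f (i n) (φB z) * wB z) p ν) ≤
      ENNReal.ofReal (w (i n)) * ENNReal.ofReal D := by gcongr
  rw [← mul_assoc, ← ENNReal.ofReal_mul hwn.le, mul_inv_cancel₀ hwn.ne', ENNReal.ofReal_one,
    one_mul, ← ENNReal.ofReal_mul hwn.le] at h3
  have h4 := h1.trans_le h3
  rw [ENNReal.ofReal_lt_ofReal_iff_of_nonneg (by positivity)] at h4
  nlinarith

end Superposition

/-! ### Chirped test distributions and their transforms -/

/-- The tempered distribution `e^{2π i (R u₁ + η u₂ + r u₂² / 2)} G(u)`. -/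
def chirpDist (R η r : ℝ) (G : 𝓢(ℝ × ℝ, ℂ)) : 𝓢'(ℝ × ℝ, ℂ) :=
  toTemperedDistributionCLM (ℝ × ℝ) ℂ volume (chirpMul R η r G)

theorem chirpDist_apply (R η r : ℝ) (G ψ : 𝓢(ℝ × ℝ, ℂ)) :
    chirpDist R η r G ψ = ∫ u, ψ u * (phaseExp (quadPhase R η r u) * G u) := by
  refine (toTemperedDistributionCLM_apply_apply volume (chirpMul R η r G) ψ).trans ?_
  simp only [chirpMul_apply, smul_eq_mul]

/-- With ψ in the first slot of the kernel, `kernelBound_decay` becomes an equicontinuity estimate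
for the family of test distributions. -/
theorem chirpDist_eq_chirpKernel (R η r : ℝ) (G ψ : 𝓢(ℝ × ℝ, ℂ)) :
    chirpDist R η r G ψ = chirpKernel ψ (schwartzConj G) (-r) 0 (-R, -η) := by
  rw [chirpDist_apply, chirpKernel]
  congr 1
  funext u
  rw [schwartzConj_apply, Complex.conj_conj, sub_zero, mul_assoc, mul_comm (G u)]
  congr 3
  simp only [quadPhase]
  ring

theorem stft_chirpDist (R η r : ℝ) (G γ : 𝓢(ℝ × ℝ, ℂ)) (z : (ℝ × ℝ) × (ℝ × ℝ)) :
    stft γ (chirpDist R η r G) z = chirpKernel G γ (-r) z.1 (z.2.1 - R, z.2.2 - η) := by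
  rw [stft, distPairing, chirpDist_apply, chirpKernel]
  congr 1
  funext u
  rw [schwartzConj_apply, tfShift_apply]
  change (starRingEnd ℂ) (phaseExp (z.2.1 * u.1 + z.2.2 * u.2) * γ (u - z.1)) * _ = _
  rw [map_mul, conj_phaseExp, show -((z.2.1 - R, z.2.2 - η).1 * u.1 + (z.2.1 - R, z.2.2 - η).2 * u.2 +
    -r / 2 * u.2 ^ 2) = -(z.2.1 * u.1 + z.2.2 * u.2) + quadPhase R η r u by
      simp only [quadPhase]; ring, phaseExp_add]
  ring

/-- The rate λx₄ - r and the first frequency λx₄ - R both move with x₄, and their difference R - r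
is fixed. This coupling, absent from `stft_chirpDist`, is what separates the two spaces. -/
theorem coeff_chirpDist (lam R η r : ℝ) (G g : 𝓢(ℝ × ℝ, ℂ)) (X : ℝ × ℝ × ℝ × ℝ) :
    G53.coeff lam g (chirpDist R η r G) (G53.ofQuot X) =
      phaseExp (lam * (X.2.1 * X.2.2.1)) * chirpKernel G g (lam * X.2.2.1 - r) (X.2.1, X.2.2.2)
        (lam * X.2.2.1 - R, -(lam * X.1) - η) := by
  rw [G53.coeff, distPairing, chirpDist_apply, chirpKernel, ← integral_const_mul]
  congr 1
  funext u
  rw [schwartzConj_apply, G53.rep_apply]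
  simp only [G53.ofQuot]
  change (starRingEnd ℂ) (phaseExp (lam * (0 - X.2.1 * X.2.2.1 + X.2.2.1 * u.1 - X.1 * u.2 +
    1 / 2 * X.2.2.1 * u.2 ^ 2)) * g (u - (X.2.1, X.2.2.2))) * _ = _
  have e : phaseExp (-(lam * (0 - X.2.1 * X.2.2.1 + X.2.2.1 * u.1 - X.1 * u.2 +
      1 / 2 * X.2.2.1 * u.2 ^ 2))) * phaseExp (quadPhase R η r u) =
      phaseExp (lam * (X.2.1 * X.2.2.1)) * phaseExp (-((lam * X.2.2.1 - R) * u.1 +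
        (-(lam * X.1) - η) * u.2 + (lam * X.2.2.1 - r) / 2 * u.2 ^ 2)) := by
    rw [← phaseExp_add, ← phaseExp_add]
    congr 1
    simp only [quadPhase]
    ring
  rw [map_mul, conj_phaseExp]
  linear_combination ((starRingEnd ℂ) (g (u - (X.2.1, X.2.2.2))) * G u) * e

/-- The linear change of variables between `G_{5,3}/Z` and the time-frequency plane. -/
def quotEquiv (lam : ℝ) (hlam : lam ≠ 0) : (ℝ × ℝ × ℝ × ℝ) ≃ₗ[ℝ] (ℝ × ℝ) × (ℝ × ℝ) where
  toFun X := ((X.2.1, X.2.2.2), (lam * X.2.2.1, -(lam * X.1)))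
  invFun z := (-(z.2.2 / lam), z.1.1, z.2.1 / lam, z.1.2)
  map_add' X Y := by
    simp only [Prod.fst_add, Prod.snd_add, Prod.mk_add_mk, Prod.mk.injEq, true_and]
    constructor <;> ring
  map_smul' a X := by
    simp only [Prod.smul_fst, Prod.smul_snd, Prod.smul_mk, smul_eq_mul, RingHom.id_apply,
      Prod.mk.injEq, true_and]
    constructor <;> ring
  left_inv X := by
    ext <;> simp [hlam, neg_div]
  right_inv z := by
    ext <;> simp <;> field_simp

theorem isAddHaarMeasure_volume_tfPlane :
    (volume : Measure ((ℝ × ℝ) × (ℝ × ℝ))).IsAddHaarMeasure :=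
  Measure.prod.instIsAddHaarMeasure volume volume

/-- The constant is a power of the Jacobian of `quotEquiv`. Only its positivity and its independence
of `h`, `R`, `η` matter, so uniqueness of Haar measure replaces a computation. -/
theorem exists_eLpNorm_quot_eq (lam : ℝ) (hlam : lam ≠ 0) (p : ℝ≥0∞) : ∃ κ : ℝ, 0 < κ ∧
    ∀ (h : (ℝ × ℝ) × (ℝ × ℝ) → ℂ), Continuous h → ∀ R η : ℝ,
      eLpNorm (fun X : ℝ × ℝ × ℝ × ℝ => h ((X.2.1, X.2.2.2), (lam * X.2.2.1 - R, -(lam * X.1) - η))) p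
        volume = ENNReal.ofReal κ * eLpNorm h p volume := by
  have h4 := isAddHaarMeasure_volume_tfPlane
  have h3 : (volume : Measure (ℝ × ℝ × ℝ)).IsAddHaarMeasure :=
    Measure.prod.instIsAddHaarMeasure volume volume
  have h5 : (volume : Measure (ℝ × ℝ × ℝ × ℝ)).IsAddHaarMeasure :=
    Measure.prod.instIsAddHaarMeasure volume volume
  set L := (quotEquiv lam hlam).toContinuousLinearEquiv with hL
  have hH : (Measure.map L (volume : Measure (ℝ × ℝ × ℝ × ℝ))).IsAddHaarMeasure :=
    L.isAddHaarMeasure_map volume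
  set c := (Measure.map L (volume : Measure (ℝ × ℝ × ℝ × ℝ))).addHaarScalarFactor
    (volume : Measure ((ℝ × ℝ) × (ℝ × ℝ))) with hc
  have hmap : Measure.map L (volume : Measure (ℝ × ℝ × ℝ × ℝ)) =
      c • (volume : Measure ((ℝ × ℝ) × (ℝ × ℝ))) := Measure.isAddLeftInvariant_eq_smul _ _
  have hc0 : c ≠ 0 := (Measure.addHaarScalarFactor_pos_of_isAddHaarMeasure _ _).ne'
  refine ⟨(c : ℝ) ^ (1 / p).toReal, by positivity, fun h hh R η => ?_⟩
  set k : (ℝ × ℝ) × (ℝ × ℝ) → ℂ := fun z => h (z + ((0, 0), (-R, -η))) with hk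
  have hkc : Continuous k := by fun_prop
  have e1 : (fun X : ℝ × ℝ × ℝ × ℝ => h ((X.2.1, X.2.2.2), (lam * X.2.2.1 - R, -(lam * X.1) - η))) =
      k ∘ L := by
    funext X
    simp [hk, hL, quotEquiv, sub_eq_add_neg]
  rw [e1, ← eLpNorm_map_measure hkc.aestronglyMeasurable L.continuous.aemeasurable, hmap,
    eLpNorm_smul_measure_of_ne_zero' hc0]
  have e2 : eLpNorm k p volume = eLpNorm h p volume :=
    eLpNorm_comp_measurePreserving hh.aestronglyMeasurable
      (measurePreserving_add_right volume (((0 : ℝ), (0 : ℝ)), (-R, -η)))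
  rw [e2, ENNReal.smul_def, smul_eq_mul, ← ENNReal.ofReal_coe_nnreal]
  simp

theorem eLpNorm_dilate {E : Type*} [NormedAddCommGroup E] (p : ℝ≥0∞) {R : ℝ} (hR : 0 < R)
    {h : (ℝ × ℝ) × (ℝ × ℝ) → E} (hh : AEStronglyMeasurable h volume) :
    eLpNorm (fun z : (ℝ × ℝ) × (ℝ × ℝ) => h (z.1, (z.2.1, z.2.2 / R))) p volume =
      ENNReal.ofReal (R ^ (1 / p).toReal) * eLpNorm h p volume := by
  set D : (ℝ × ℝ) × (ℝ × ℝ) → (ℝ × ℝ) × (ℝ × ℝ) := Prod.map id (Prod.map id fun t => R⁻¹ * t) with hD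
  have hR0 : ENNReal.ofReal R ≠ 0 := by simpa using hR
  have hm : Measurable fun t : ℝ => R⁻¹ * t := by fun_prop
  have hDm : Measurable D := measurable_id.prodMap (measurable_id.prodMap hm)
  have hmap : Measure.map D volume = ENNReal.ofReal R • (volume : Measure ((ℝ × ℝ) × (ℝ × ℝ))) := by
    have e1 : Measure.map (fun t : ℝ => R⁻¹ * t) volume = ENNReal.ofReal R • volume := by
      rw [Real.map_volume_mul_left (inv_ne_zero hR.ne'), inv_inv, abs_of_pos hR]
    rw [Measure.volume_eq_prod, hD, ← Measure.map_prod_map _ _ measurable_id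
      (measurable_id.prodMap hm), Measure.map_id, Measure.volume_eq_prod ℝ ℝ,
      ← Measure.map_prod_map _ _ measurable_id hm, Measure.map_id, e1, Measure.prod_smul_right,
      Measure.prod_smul_right]
  have e : (fun z : (ℝ × ℝ) × (ℝ × ℝ) => h (z.1, (z.2.1, z.2.2 / R))) = h ∘ D := by
    funext z
    simp only [div_eq_inv_mul]
    rfl
  rw [e, ← eLpNorm_map_measure (by rw [hmap]; exact hh.smul_measure _) hDm.aemeasurable, hmap,
    eLpNorm_smul_measure_of_ne_zero hR0, smul_eq_mul, ENNReal.ofReal_rpow_of_pos hR]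

/-- The majorant `∏ (1 + zᵢ²)⁻¹` on the time-frequency plane. -/
def majorant (z : (ℝ × ℝ) × (ℝ × ℝ)) : ℝ :=
  ((1 + z.1.1 ^ 2)⁻¹ * (1 + z.1.2 ^ 2)⁻¹) * ((1 + z.2.1 ^ 2)⁻¹ * (1 + z.2.2 ^ 2)⁻¹)

theorem majorant_pos (z : (ℝ × ℝ) × (ℝ × ℝ)) : 0 < majorant z := by unfold majorant; positivity

theorem continuous_majorant : Continuous majorant := by
  have h : Continuous fun t : ℝ => (1 + t ^ 2)⁻¹ :=
    Continuous.inv₀ (by fun_prop) fun t => by positivity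
  unfold majorant
  exact ((h.comp (by fun_prop)).mul (h.comp (by fun_prop))).mul
    ((h.comp (by fun_prop)).mul (h.comp (by fun_prop)))

theorem memLp_majorant {p : ℝ≥0∞} (hp : 1 ≤ p) : MemLp majorant p volume := by
  have hi : Integrable majorant := by
    have h2 : Integrable (fun z : ℝ × ℝ => (1 + z.1 ^ 2)⁻¹ * (1 + z.2 ^ 2)⁻¹)
        ((volume : Measure ℝ).prod volume) := integrable_inv_one_add_sq.mul_prod integrable_inv_one_add_sq
    exact h2.mul_prod h2
  have hinv : ∀ t : ℝ, (1 + t ^ 2)⁻¹ ≤ 1 := fun t => inv_le_one_of_one_le₀ (by nlinarith [sq_nonneg t])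
  have hb : ∀ z, majorant z ≤ 1 := by
    intro z
    have := hinv
    exact mul_le_one₀ (mul_le_one₀ (hinv _) (by positivity) (hinv _)) (by positivity)
      (mul_le_one₀ (hinv _) (by positivity) (hinv _))
  rcases eq_or_ne p ∞ with rfl | hpt
  · refine memLp_top_of_bound continuous_majorant.aestronglyMeasurable 1 ?_
    filter_upwards with z
    rw [Real.norm_of_nonneg (majorant_pos z).le]
    exact hb z
  · have hp1 : 1 ≤ p.toReal := by
      rw [← ENNReal.toReal_one]; exact ENNReal.toReal_mono hpt hp
    rw [← integrable_norm_rpow_iff continuous_majorant.aestronglyMeasurable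
      (by rintro rfl; simp at hp) hpt]
    refine hi.mono' ?_ ?_
    · exact (continuous_majorant.norm.rpow_const fun z => Or.inr (by linarith)).aestronglyMeasurable
    · filter_upwards with z
      rw [Real.norm_of_nonneg (by positivity), Real.norm_of_nonneg (majorant_pos z).le]
      exact (Real.rpow_le_rpow_of_exponent_ge (majorant_pos z) (hb z) hp1).trans_eq (Real.rpow_one _)

/-- `L^p` bound of a function dominated by a dilated majorant. -/
theorem exists_eLpNorm_le_of_majorant {p : ℝ≥0∞} (hp : 1 ≤ p) : ∃ B : ℝ, 0 < B ∧
    ∀ (h : (ℝ × ℝ) × (ℝ × ℝ) → ℂ) (A R : ℝ), 0 ≤ A → 0 < R →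
      (∀ z, ‖h z‖ ≤ A * majorant (z.1, (z.2.1, z.2.2 / R))) →
      eLpNorm h p volume ≤ ENNReal.ofReal (A * R ^ (1 / p).toReal * B) := by
  refine ⟨(eLpNorm majorant p volume).toReal + 1, by positivity, fun h A R hA hR hb => ?_⟩
  have hfin := (memLp_majorant hp).2.ne
  calc eLpNorm h p volume
      ≤ ENNReal.ofReal A *
        eLpNorm (fun z : (ℝ × ℝ) × (ℝ × ℝ) => majorant (z.1, (z.2.1, z.2.2 / R))) p volume := by
        refine eLpNorm_le_mul_eLpNorm_of_ae_le_mul (ae_of_all _ fun z => ?_) p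
        rw [Real.norm_of_nonneg (majorant_pos _).le]
        exact hb z
    _ = ENNReal.ofReal A * (ENNReal.ofReal (R ^ (1 / p).toReal) * eLpNorm majorant p volume) := by
        rw [eLpNorm_dilate p hR continuous_majorant.aestronglyMeasurable]
    _ ≤ ENNReal.ofReal A * (ENNReal.ofReal (R ^ (1 / p).toReal) *
        ENNReal.ofReal ((eLpNorm majorant p volume).toReal + 1)) := by
        gcongr
        rw [← ENNReal.ofReal_toReal hfin]
        apply ENNReal.ofReal_le_ofReal
        simp
    _ = _ := by
        rw [← ENNReal.ofReal_mul (by positivity), ← ENNReal.ofReal_mul hA, mul_assoc]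

/-- The two hypotheses say that 1 + |r| is comparable to R up to a factor 1 + |ω₁|, which the decay
in ω₁ absorbs. This covers rates such as ω₁ + R, which vanish somewhere. The power N leaves room for
a moderate weight. -/
theorem exists_chirpKernel_le_majorant (F γ : 𝓢(ℝ × ℝ, ℂ)) (N : ℕ) : ∃ C : ℝ, 0 < C ∧
    ∀ (R r : ℝ) (x ω : ℝ × ℝ), 1 ≤ R → 1 + |r| ≤ 2 * R * (1 + |ω.1|) →
      R ≤ (1 + |r|) * (1 + |ω.1|) →
      √R * (((1 + |x.1|) * (1 + |x.2|) * ((1 + |ω.1|) * (1 + |ω.2| / R))) ^ N *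
        ‖chirpKernel F γ r x ω‖) ≤ C * majorant (x, (ω.1, ω.2 / R)) := by
  -- The exponent is dictated by c = 1 + |ω₁|: N + 2 factors from the weight and the majorant, N + 2
  -- more from e ≤ 2cd, and one from √R ≤ s c.
  obtain ⟨q, -, -, hq⟩ := kernelBound_decay (2 * N + 5) γ
  refine ⟨2 ^ (N + 2) * (|q F| + 1), by positivity, fun R r x ω hR h1 h2 => ?_⟩
  have hk := (hq F r x ω).trans ((le_abs_self (q F)).trans (le_add_of_nonneg_right zero_le_one))
  set K := ‖chirpKernel F γ r x ω‖ with hK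
  have hK0 : 0 ≤ K := norm_nonneg _
  set a := 1 + |x.1| with ha
  set b := 1 + |x.2| with hb
  set c := 1 + |ω.1| with hc
  set d := 1 + |ω.2| / (1 + |r|) with hd
  set e := 1 + |ω.2| / R with he
  set s := √(1 + |r|) with hs
  have hR0 : 0 < R := by linarith
  have hr0 : 0 < 1 + |r| := by positivity
  have ha1 : 1 ≤ a := by simp [ha]
  have hb1 : 1 ≤ b := by simp [hb]
  have hc1 : 1 ≤ c := by simp [hc]
  have hd1 : 1 ≤ d := by rw [hd]; linarith [show 0 ≤ |ω.2| / (1 + |r|) by positivity]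
  have he1 : 1 ≤ e := by rw [he]; linarith [show 0 ≤ |ω.2| / R by positivity]
  have hsR : √R ≤ s * c := by
    rw [hs, Real.sqrt_le_left (by positivity), mul_pow, Real.sq_sqrt hr0.le]
    nlinarith
  have hed : e ≤ 2 * (c * d) := by
    have h3 : |ω.2| / R ≤ 2 * c * (|ω.2| / (1 + |r|)) := by
      rw [mul_div_assoc', div_le_div_iff₀ hR0 hr0]
      nlinarith [mul_le_mul_of_nonneg_left h1 (abs_nonneg ω.2)]
    rw [he, hd]
    nlinarith
  have hmaj : ((a * b * (c * e)) ^ 2)⁻¹ ≤ majorant (x, (ω.1, ω.2 / R)) := by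
    have h4 : ∀ t : ℝ, ((1 + |t|) ^ 2)⁻¹ ≤ (1 + t ^ 2)⁻¹ := by
      intro t
      apply inv_anti₀ (by positivity)
      nlinarith [abs_nonneg t, sq_abs t]
    have h5 := h4 (ω.2 / R)
    rw [abs_div, abs_of_pos hR0] at h5
    have h6 : ((a * b * (c * e)) ^ 2)⁻¹ = ((a ^ 2)⁻¹ * (b ^ 2)⁻¹) * ((c ^ 2)⁻¹ * (e ^ 2)⁻¹) := by
      rw [mul_pow, mul_pow, mul_pow, mul_inv, mul_inv, mul_inv]
    rw [h6]
    unfold majorant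
    exact mul_le_mul (mul_le_mul (h4 x.1) (h4 x.2) (by positivity) (by positivity))
      (mul_le_mul (h4 ω.1) h5 (by positivity) (by positivity)) (by positivity) (by positivity)
  have hpos : 0 < a * b * (c * e) := by positivity
  have hmain : √R * ((a * b * (c * e)) ^ N * K) * (a * b * (c * e)) ^ 2 ≤
      2 ^ (N + 2) * (|q F| + 1) := by
    calc √R * ((a * b * (c * e)) ^ N * K) * (a * b * (c * e)) ^ 2
        = √R * (a * b * (c * e)) ^ (N + 2) * K := by ring
      _ ≤ (s * c) * (a * b * (c * (2 * (c * d)))) ^ (N + 2) * K := by gcongr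
      _ = 2 ^ (N + 2) * (s * (a ^ (N + 2) * b ^ (N + 2) * (c ^ (2 * N + 5) * d ^ (N + 2))) * K) := by
          have ec : c ^ (2 * N + 5) = c ^ (N + 2) * c ^ (N + 2) * c := by
            rw [← pow_add, ← pow_succ]
            congr 1
            omega
          rw [ec]
          generalize N + 2 = M
          clear_value a b c d s K
          simp only [mul_pow]
          ring
      _ ≤ 2 ^ (N + 2) * (s * (a ^ (2 * N + 5) * b ^ (2 * N + 5) *
          (c ^ (2 * N + 5) * d ^ (2 * N + 5))) * K) := by
          have hN : N + 2 ≤ 2 * N + 5 := by omega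
          have ea := pow_le_pow_right₀ ha1 hN
          have eb := pow_le_pow_right₀ hb1 hN
          have ed := pow_le_pow_right₀ hd1 hN
          gcongr
      _ ≤ _ := by gcongr
  calc √R * ((a * b * (c * e)) ^ N * K)
      = (√R * ((a * b * (c * e)) ^ N * K) * (a * b * (c * e)) ^ 2) * ((a * b * (c * e)) ^ 2)⁻¹ := by
        field_simp
    _ ≤ (2 ^ (N + 2) * (|q F| + 1)) * majorant (x, (ω.1, ω.2 / R)) := by
        gcongr

/-! ### Norms of the test distributions -/

/-- The polynomial decay in R and η allows normalizing weights `w` that themselves tend to 0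
polynomially. -/
theorem exists_chirpDist_bound (G : 𝓢(ℝ × ℝ, ℂ)) (N : ℕ) : ∃ q : 𝓢(ℝ × ℝ, ℂ) → ℝ,
    Continuous q ∧ q 0 = 0 ∧ ∀ R η r ψ,
      ((1 + |R|) * (1 + |η| / (1 + |r|))) ^ N * ‖chirpDist R η r G ψ‖ ≤ q ψ := by
  obtain ⟨q, hq, hq0, hb⟩ := kernelBound_decay N (schwartzConj G)
  refine ⟨q, hq, hq0, fun R η r ψ => ?_⟩
  have h := hb ψ (-r) 0 (-R, -η)
  rw [← chirpDist_eq_chirpKernel] at h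
  simp only [Prod.fst_zero, Prod.snd_zero, abs_zero, add_zero, one_pow, one_mul, abs_neg] at h
  refine le_trans ?_ h
  rw [mul_pow, mul_assoc √(1 + |r|)]
  refine le_mul_of_one_le_left (by positivity) ?_
  rw [Real.one_le_sqrt]
  linarith [abs_nonneg r]

theorem continuous_coeff_chirpDist (lam R η r : ℝ) (G g : 𝓢(ℝ × ℝ, ℂ)) :
    Continuous fun X => G53.coeff lam g (chirpDist R η r G) (G53.ofQuot X) := by
  simp_rw [coeff_chirpDist]
  refine Continuous.mul (by fun_prop) ?_
  exact Continuous.chirpKernel G g (by fun_prop) (by fun_prop) (by fun_prop)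

theorem continuous_stft_chirpDist (R η r : ℝ) (G γ : 𝓢(ℝ × ℝ, ℂ)) :
    Continuous (stft γ (chirpDist R η r G)) := by
  have : stft γ (chirpDist R η r G) =
      fun z => chirpKernel G γ (-r) z.1 (z.2.1 - R, z.2.2 - η) := funext (stft_chirpDist R η r G γ)
  rw [this]
  exact Continuous.chirpKernel G γ (by fun_prop) (by fun_prop) (by fun_prop)

theorem aestronglyMeasurable_stft_chirpDist {m : (ℝ × ℝ) × (ℝ × ℝ) → ℝ} (hm : Measurable m)
    (R η r : ℝ) (G γ : 𝓢(ℝ × ℝ, ℂ)) :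
    AEStronglyMeasurable (fun z => stft γ (chirpDist R η r G) z * (m z : ℂ)) volume :=
  (continuous_stft_chirpDist R η r G γ).aestronglyMeasurable.mul
    (Complex.measurable_ofReal.comp hm).aestronglyMeasurable

theorem continuous_chirpKernel_affine (F γ : 𝓢(ℝ × ℝ, ℂ)) (a b : ℝ) :
    Continuous fun z : (ℝ × ℝ) × (ℝ × ℝ) => chirpKernel F γ (a * z.2.1 + b) z.1 z.2 :=
  Continuous.chirpKernel F γ (by fun_prop) (by fun_prop) (by fun_prop)

theorem exists_eLpNorm_coeff_chirpDist (lam : ℝ) (hlam : lam ≠ 0) (p : ℝ≥0∞) : ∃ κ : ℝ, 0 < κ ∧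
    ∀ (G g : 𝓢(ℝ × ℝ, ℂ)) (R η r : ℝ),
      eLpNorm (fun X => G53.coeff lam g (chirpDist R η r G) (G53.ofQuot X)) p volume =
        ENNReal.ofReal κ * eLpNorm (fun z : (ℝ × ℝ) × (ℝ × ℝ) =>
          chirpKernel G g (z.2.1 + (R - r)) z.1 z.2) p volume := by
  obtain ⟨κ, hκ, h⟩ := exists_eLpNorm_quot_eq lam hlam p
  refine ⟨κ, hκ, fun G g R η r => ?_⟩
  have hc := continuous_chirpKernel_affine G g 1 (R - r)
  simp only [one_mul] at hc
  rw [← h _ hc R η]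
  refine eLpNorm_congr_norm_ae (ae_of_all _ fun X => ?_)
  rw [coeff_chirpDist, norm_mul, norm_phaseExp, one_mul]
  congr 2
  ring

theorem eLpNorm_stft_chirpDist {m : (ℝ × ℝ) × (ℝ × ℝ) → ℝ} (hm : Measurable m) (p : ℝ≥0∞)
    (G γ : 𝓢(ℝ × ℝ, ℂ)) (R η r : ℝ) :
    eLpNorm (fun z => stft γ (chirpDist R η r G) z * (m z : ℂ)) p volume =
      eLpNorm (fun z => chirpKernel G γ (-r) z.1 z.2 * (m (z + (0, (R, η))) : ℂ)) p volume := by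
  have hH := isAddHaarMeasure_volume_tfPlane
  have hmeas := aestronglyMeasurable_stft_chirpDist hm R η r G γ
  have h := eLpNorm_comp_measurePreserving (p := p) hmeas
    (measurePreserving_add_right volume (((0 : ℝ × ℝ), (R, η)) : (ℝ × ℝ) × (ℝ × ℝ)))
  rw [← h]
  congr 1
  funext z
  simp only [Function.comp_apply, stft_chirpDist]
  simp

section Inclusions

variable {p : ℝ≥0∞} {lam : ℝ} {m : (ℝ × ℝ) × (ℝ × ℝ) → ℝ} {g γ : 𝓢(ℝ × ℝ, ℂ)}
  {ι : Type*} {R η r w : ι → ℝ} {G : 𝓢(ℝ × ℝ, ℂ)} {q : 𝓢(ℝ × ℝ, ℂ) → ℝ} {C : ℝ}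

theorem exists_modulation_bound (hp : 1 ≤ p) (hm : Measurable m)
    (hsub : G53.coorbitSpace lam p g ⊆ modulationSpace p m γ) (hw : ∀ i, 0 < w i)
    (hq : Continuous q) (hq0 : q 0 = 0)
    (hfq : ∀ i ψ, ‖chirpDist (R i) (η i) (r i) G ψ‖ ≤ w i * q ψ)
    (hC : ∀ i, eLpNorm (fun X => G53.coeff lam g (chirpDist (R i) (η i) (r i) G) (G53.ofQuot X)) p
      volume ≤ ENNReal.ofReal (C * w i)) :
    ∃ D : ℝ, 0 < D ∧ ∀ i, eLpNorm (fun z => stft γ (chirpDist (R i) (η i) (r i) G) z * (m z : ℂ)) p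
      volume ≤ ENNReal.ofReal (D * w i) := by
  have h := exists_bound_of_inclusion (μ := volume) (ν := volume) (p := p)
    (f := fun i => chirpDist (R i) (η i) (r i) G)
    (φA := fun X : ℝ × ℝ × ℝ × ℝ => schwartzConj (G53.rep lam (G53.ofQuot X) g)) (wA := fun _ => 1)
    (φB := fun z : (ℝ × ℝ) × (ℝ × ℝ) => schwartzConj (tfShift z.1 z.2 γ)) (wB := fun z => (m z : ℂ)) hp
    (fun f hf => by
      simp only [mul_one] at hf
      exact hsub hf) hw hq hq0 hfq
    (fun i => by
      simp only [mul_one]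
      exact (continuous_coeff_chirpDist lam _ _ _ G g).aestronglyMeasurable)
    (fun i => aestronglyMeasurable_stft_chirpDist hm (R i) (η i) (r i) G γ) (C := C)
    (fun i => by
      simp only [mul_one]
      exact hC i)
  exact h

theorem exists_coorbit_bound (hp : 1 ≤ p) (hm : Measurable m)
    (hsub : modulationSpace p m γ ⊆ G53.coorbitSpace lam p g) (hw : ∀ i, 0 < w i)
    (hq : Continuous q) (hq0 : q 0 = 0)
    (hfq : ∀ i ψ, ‖chirpDist (R i) (η i) (r i) G ψ‖ ≤ w i * q ψ)
    (hC : ∀ i, eLpNorm (fun z => stft γ (chirpDist (R i) (η i) (r i) G) z * (m z : ℂ)) p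
      volume ≤ ENNReal.ofReal (C * w i)) :
    ∃ D : ℝ, 0 < D ∧ ∀ i, eLpNorm (fun X => G53.coeff lam g (chirpDist (R i) (η i) (r i) G)
      (G53.ofQuot X)) p volume ≤ ENNReal.ofReal (D * w i) := by
  have h := exists_bound_of_inclusion (μ := volume) (ν := volume) (p := p)
    (f := fun i => chirpDist (R i) (η i) (r i) G)
    (φB := fun X : ℝ × ℝ × ℝ × ℝ => schwartzConj (G53.rep lam (G53.ofQuot X) g)) (wB := fun _ => 1)
    (φA := fun z : (ℝ × ℝ) × (ℝ × ℝ) => schwartzConj (tfShift z.1 z.2 γ)) (wA := fun z => (m z : ℂ)) hp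
    (fun f hf => by
      simp only [mul_one]
      exact hsub hf) hw hq hq0 hfq
    (fun i => aestronglyMeasurable_stft_chirpDist hm (R i) (η i) (r i) G γ)
    (fun i => by
      simp only [mul_one]
      exact (continuous_coeff_chirpDist lam _ _ _ G g).aestronglyMeasurable) (C := C) hC
  simp only [mul_one] at h
  exact h

end Inclusions

/-! ### Moderate weights and lower bounds for `L^p` norms. -/

theorem norm_tfPlane_le (z : (ℝ × ℝ) × (ℝ × ℝ)) :
    1 + ‖z‖ ≤ (1 + |z.1.1|) * (1 + |z.1.2|) * ((1 + |z.2.1|) * (1 + |z.2.2|)) := by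
  have h : ‖z‖ ≤ |z.1.1| + |z.1.2| + (|z.2.1| + |z.2.2|) := by
    rw [Prod.norm_def, Prod.norm_def, Prod.norm_def]
    simp only [Real.norm_eq_abs]
    have := abs_nonneg z.1.1
    have := abs_nonneg z.1.2
    have := abs_nonneg z.2.1
    have := abs_nonneg z.2.2
    refine max_le (max_le ?_ ?_) (max_le ?_ ?_) <;> linarith
  have ha := abs_nonneg z.1.1
  have hb := abs_nonneg z.1.2
  have hc := abs_nonneg z.2.1
  have hd := abs_nonneg z.2.2
  have h1 : 1 + (|z.1.1| + |z.1.2|) ≤ (1 + |z.1.1|) * (1 + |z.1.2|) := by nlinarith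
  have h2 : 1 + (|z.2.1| + |z.2.2|) ≤ (1 + |z.2.1|) * (1 + |z.2.2|) := by nlinarith
  refine le_trans ?_ (mul_le_mul h1 h2 (by positivity) (by positivity))
  nlinarith [mul_nonneg (add_nonneg ha hb) (add_nonneg hc hd)]

theorem IsModerateWeight.exists_two_sided {m : (ℝ × ℝ) × (ℝ × ℝ) → ℝ} (hm : IsModerateWeight m) :
    ∃ (C : ℝ) (N : ℕ), 0 < C ∧ (∀ z w, m (z + w) ≤ C * (1 + ‖z‖) ^ N * m w) ∧
      ∀ z w, m w ≤ C * (1 + ‖z‖) ^ N * m (z + w) := by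
  obtain ⟨C, N, h⟩ := hm.moderate
  refine ⟨C, N, ?_, h, fun z w => ?_⟩
  · have h0 := h 0 0
    have hp := hm.pos 0
    simp only [add_zero, norm_zero, one_pow, mul_one] at h0
    by_contra hC
    nlinarith
  · simpa using h (-z) (z + w)

/-- A point shifted by `R` in the first frequency splits off the large part `(R, ω₂)` of its frequency. -/
theorem tfPlane_split (z : (ℝ × ℝ) × (ℝ × ℝ)) (R : ℝ) :
    z + (0, (R, 0)) = (z.1, (z.2.1, (0 : ℝ))) + (0, (R, z.2.2)) := by
  ext <;> simp

theorem chirpKernel_self_ne_zero {g : 𝓢(ℝ × ℝ, ℂ)} (hg : g ≠ 0) : chirpKernel g g 0 0 0 ≠ 0 := by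
  obtain ⟨a, ha⟩ : ∃ u, g u ≠ 0 := by
    by_contra! h
    exact hg (SchwartzMap.ext h)
  have hc := g.continuous
  have e : chirpKernel g g 0 0 0 = ((∫ u, ‖g u‖ ^ 2 : ℝ) : ℂ) := by
    rw [chirpKernel, ← integral_complex_ofReal]
    congr 1
    funext u
    simp only [sub_zero, Prod.fst_zero, Prod.snd_zero, zero_mul, zero_div, add_zero, neg_zero,
      phaseExp_zero, mul_one, Complex.mul_conj']
    push_cast
    rfl
  rw [e, Complex.ofReal_ne_zero]
  have hi : Integrable fun u => ‖g u‖ ^ 2 := by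
    refine (g.integrable.norm.mul_const (schwartzSup g)).mono'
      (by apply Continuous.aestronglyMeasurable; fun_prop) ?_
    filter_upwards with s
    rw [Real.norm_of_nonneg (by positivity), sq]
    exact mul_le_mul_of_nonneg_left (norm_le_schwartzSup _ _) (norm_nonneg _)
  refine (integral_pos_of_integrable_nonneg_nonzero (x := a) (by fun_prop) hi
      (fun s => by positivity) ?_).ne'
  simpa using ha

theorem exists_le_eLpNorm_of_continuous {p : ℝ≥0∞} (hp : 1 ≤ p) {l : (ℝ × ℝ) × (ℝ × ℝ) → ℝ}
    (hl : Continuous l) {z₀ : (ℝ × ℝ) × (ℝ × ℝ)} (h0 : l z₀ ≠ 0) :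
    ∃ c : ℝ, 0 < c ∧ ENNReal.ofReal c ≤ eLpNorm l p volume := by
  obtain ⟨c, hc, h⟩ := eventually_le_eLpNorm_of_tendsto (μ := volume) (p := p)
    (by rintro rfl; simp at hp) (k := fun _ => l) (fun _ => hl.aestronglyMeasurable) hl
    hl.aestronglyMeasurable (fun z => tendsto_const_nhds) h0
  obtain ⟨n, hn⟩ := h.exists
  exact ⟨c, hc, hn⟩

/-- Lower bound for `L^p` norms of functions that concentrate, after a dilation of the last
variable, with height `(n + 1)^{-1/2}`. -/
theorem eventually_le_eLpNorm_dilated {p : ℝ≥0∞} (hp : 1 ≤ p) {k : ℕ → (ℝ × ℝ) × (ℝ × ℝ) → ℝ}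
    {l : (ℝ × ℝ) × (ℝ × ℝ) → ℝ} (hk : ∀ n, Continuous (k n)) (hl : Continuous l)
    (hlim : ∀ z : (ℝ × ℝ) × (ℝ × ℝ), Tendsto (fun n : ℕ =>
      √((n : ℝ) + 1) * k n (z.1, (z.2.1, ((n : ℝ) + 1) * z.2.2))) atTop (𝓝 (l z)))
    {z₀ : (ℝ × ℝ) × (ℝ × ℝ)} (h0 : l z₀ ≠ 0) :
    ∃ c : ℝ, 0 < c ∧ ∀ᶠ n : ℕ in atTop,
      ENNReal.ofReal (c * ((n : ℝ) + 1) ^ ((1 / p).toReal - 1 / 2)) ≤ eLpNorm (k n) p volume := by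
  set h : ℕ → (ℝ × ℝ) × (ℝ × ℝ) → ℝ := fun n z => k n (z.1, (z.2.1, ((n : ℝ) + 1) * z.2.2)) with hh
  have hhc : ∀ n, Continuous (h n) := fun n => (hk n).comp (by fun_prop)
  obtain ⟨c, hc, hev⟩ := eventually_le_eLpNorm_of_tendsto (μ := volume) (p := p)
    (by rintro rfl; simp at hp) (k := fun n z => √((n : ℝ) + 1) * h n z)
    (fun n => (continuous_const.mul (hhc n)).aestronglyMeasurable) hl hl.aestronglyMeasurable hlim h0
  refine ⟨c, hc, ?_⟩
  filter_upwards [hev] with n hn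
  have hR : (0 : ℝ) < (n : ℝ) + 1 := by positivity
  -- Undoing the dilation contributes (n + 1)^{1/p}, and the normalization contributes (n +
  -- 1)^{-1/2}.
  have e1 : k n = fun z => h n (z.1, (z.2.1, z.2.2 / ((n : ℝ) + 1))) := by
    funext z
    simp only [hh]
    congr 3
    field_simp
  have e2 : eLpNorm (fun z => √((n : ℝ) + 1) * h n z) p volume =
      ENNReal.ofReal √((n : ℝ) + 1) * eLpNorm (h n) p volume := by
    have := eLpNorm_const_smul (μ := volume) √((n : ℝ) + 1) (h n) p
    rw [Real.enorm_of_nonneg (Real.sqrt_nonneg _)] at this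
    exact this
  rw [e2] at hn
  rw [e1, eLpNorm_dilate p hR (hhc n).aestronglyMeasurable]
  have hs : 0 < √((n : ℝ) + 1) := Real.sqrt_pos.2 hR
  have h3 : ENNReal.ofReal (c / √((n : ℝ) + 1)) ≤ eLpNorm (h n) p volume := by
    rw [ENNReal.ofReal_div_of_pos hs]
    refine ENNReal.div_le_of_le_mul ?_
    rwa [mul_comm]
  refine le_trans (le_of_eq ?_) (mul_le_mul_right h3 _)
  rw [← ENNReal.ofReal_mul (by positivity)]
  congr 1
  rw [Real.rpow_sub hR, ← Real.sqrt_eq_rpow]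
  ring

/-! ### Lower bounds -/

/-- This is the coorbit side for r = 0 and R = n + 1; the fixed ω₁ plays the role of the offset in
`tendsto_chirpKernel`. -/
theorem eventually_le_eLpNorm_chirpKernel_growing {p : ℝ≥0∞} (hp : 1 ≤ p) {g : 𝓢(ℝ × ℝ, ℂ)}
    (hg : g ≠ 0) : ∃ c : ℝ, 0 < c ∧ ∀ᶠ n : ℕ in atTop,
      ENNReal.ofReal (c * ((n : ℝ) + 1) ^ ((1 / p).toReal - 1 / 2)) ≤
        eLpNorm (fun z : (ℝ × ℝ) × (ℝ × ℝ) => chirpKernel g g (z.2.1 + ((n : ℝ) + 1)) z.1 z.2) p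
          volume := by
  obtain ⟨t, ht⟩ := exists_sliceKernel_ne_zero hg
  have hcont : ∀ n : ℕ, Continuous fun z : (ℝ × ℝ) × (ℝ × ℝ) =>
      ‖chirpKernel g g (z.2.1 + ((n : ℝ) + 1)) z.1 z.2‖ := fun n =>
    (Continuous.chirpKernel g g (by fun_prop) (by fun_prop) (by fun_prop)).norm
  have hlc : Continuous fun z : (ℝ × ℝ) × (ℝ × ℝ) =>
      2 * ‖fresnelLim‖ * ‖sliceKernel g g z.1 z.2.1 (-z.2.2)‖ := by
    have h := (continuous_sliceKernel g g).comp (by fun_prop :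
      Continuous fun z : (ℝ × ℝ) × (ℝ × ℝ) => (z.1, (z.2.1, -z.2.2)))
    exact continuous_const.mul h.norm
  have hlim : ∀ z : (ℝ × ℝ) × (ℝ × ℝ), Tendsto (fun n : ℕ => √((n : ℝ) + 1) *
      ‖chirpKernel g g (z.2.1 + ((n : ℝ) + 1)) z.1 (z.2.1, ((n : ℝ) + 1) * z.2.2)‖) atTop
      (𝓝 (2 * ‖fresnelLim‖ * ‖sliceKernel g g z.1 z.2.1 (-z.2.2)‖)) := by
    intro z
    have := tendsto_chirpKernel g g z.1 z.2.1 z.2.1 z.2.2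
    simpa only [add_comm z.2.1] using this
  have hne : 2 * ‖fresnelLim‖ * ‖sliceKernel g g 0 0 (- -t)‖ ≠ 0 := by
    rw [neg_neg]
    exact mul_ne_zero (mul_ne_zero two_ne_zero (norm_ne_zero_iff.2 fresnelLim_ne_zero))
      (norm_ne_zero_iff.2 ht)
  obtain ⟨c, hc, hev⟩ := eventually_le_eLpNorm_dilated hp hcont hlc hlim (z₀ := (0, (0, -t))) hne
  refine ⟨c, hc, ?_⟩
  filter_upwards [hev] with n hn
  rwa [eLpNorm_norm] at hn

/-- The weight is frozen at ω₂ = 0 because ω₂ is dilated by n + 1: a weight decaying in ω₂ would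
spoil the limit. -/
theorem eventually_le_eLpNorm_chirpKernel_weighted {p : ℝ≥0∞} (hp : 1 ≤ p) {γ : 𝓢(ℝ × ℝ, ℂ)}
    (hγ : γ ≠ 0) {v : (ℝ × ℝ) × (ℝ × ℝ) → ℝ} (hv : Continuous v) (hv0 : ∀ z, v z ≠ 0) :
    ∃ c : ℝ, 0 < c ∧ ∀ᶠ n : ℕ in atTop,
      ENNReal.ofReal (c * ((n : ℝ) + 1) ^ ((1 / p).toReal - 1 / 2)) ≤
        eLpNorm (fun z : (ℝ × ℝ) × (ℝ × ℝ) => ‖chirpKernel γ γ (-((n : ℝ) + 1)) z.1 z.2‖ *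
          v (z.1, (z.2.1, 0))) p volume := by
  obtain ⟨t, ht⟩ := exists_sliceKernel_ne_zero hγ
  have hv' : Continuous fun z : (ℝ × ℝ) × (ℝ × ℝ) => v (z.1, (z.2.1, 0)) :=
    hv.comp (by fun_prop)
  have hcont : ∀ n : ℕ, Continuous fun z : (ℝ × ℝ) × (ℝ × ℝ) =>
      ‖chirpKernel γ γ (-((n : ℝ) + 1)) z.1 z.2‖ * v (z.1, (z.2.1, 0)) := fun n =>
    (Continuous.chirpKernel γ γ (by fun_prop) (by fun_prop) (by fun_prop)).norm.mul hv'
  have hlc : Continuous fun z : (ℝ × ℝ) × (ℝ × ℝ) =>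
      2 * ‖fresnelLim‖ * ‖sliceKernel γ γ z.1 z.2.1 z.2.2‖ * v (z.1, (z.2.1, 0)) :=
    (continuous_const.mul (continuous_sliceKernel γ γ).norm).mul hv'
  refine eventually_le_eLpNorm_dilated hp hcont hlc (fun z => ?_) (z₀ := (0, (0, t))) ?_
  · have := (tendsto_chirpKernel_neg γ γ z.1 z.2.1 z.2.2).mul_const (v (z.1, (z.2.1, 0)))
    simpa only [mul_assoc] using this
  · have h1 := norm_ne_zero_iff.2 fresnelLim_ne_zero
    have h2 := norm_ne_zero_iff.2 ht
    have h3 := hv0 (0, (0, 0))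
    exact mul_ne_zero (mul_ne_zero (mul_ne_zero two_ne_zero h1) h2) h3

/-! ### The two ranges of exponents -/

section Ranges

variable {p : ℝ≥0∞} {lam : ℝ} {m : (ℝ × ℝ) × (ℝ × ℝ) → ℝ} {g γ : 𝓢(ℝ × ℝ, ℂ)}

theorem continuous_weight_inv (C : ℝ) (N : ℕ) (hC : 0 < C) :
    Continuous fun z : (ℝ × ℝ) × (ℝ × ℝ) => (C * (1 + ‖z‖) ^ N)⁻¹ :=
  Continuous.inv₀ (by fun_prop) fun z => by positivity

/-- Pure modulations (r = 0) have modulation norm at most a multiple of m(0,(R,η)) and coorbit norm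
of order at least R^{α-1/2}. Taking `g` itself as envelope makes the latter kernel a
self-correlation. Uniformity in η is essential: the chirps used afterwards spread over a length R in
ω₂, where moderateness alone would lose powers of R. -/
theorem exists_weight_lower_bound (hp : 1 ≤ p) (hlam : lam ≠ 0) (hm : IsModerateWeight m)
    (hg : g ≠ 0) (hsub : modulationSpace p m γ ⊆ G53.coorbitSpace lam p g) :
    ∃ c : ℝ, 0 < c ∧ ∀ᶠ n : ℕ in atTop, ∀ η : ℝ,
      c * ((n : ℝ) + 1) ^ ((1 / p).toReal - 1 / 2) ≤ m (0, ((n : ℝ) + 1, η)) := by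
  obtain ⟨C₀, N, hC₀, hm1, hm2⟩ := hm.exists_two_sided
  obtain ⟨κ, hκ, hcoeff⟩ := exists_eLpNorm_coeff_chirpDist lam hlam p
  obtain ⟨B, hB, hmaj⟩ := exists_eLpNorm_le_of_majorant hp
  obtain ⟨C, hC, hker⟩ := exists_chirpKernel_le_majorant g γ N
  obtain ⟨q, hq, hq0, hqb⟩ := exists_chirpDist_bound g N
  have hm0 := hm.pos 0
  obtain ⟨D, hD, hbound⟩ : ∃ D : ℝ, 0 < D ∧ ∀ i : ℝ × ℝ,
      eLpNorm (fun X => G53.coeff lam g (chirpDist i.1 i.2 0 g) (G53.ofQuot X)) p volume ≤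
        ENNReal.ofReal (D * m (0, i)) := by
    refine exists_coorbit_bound (R := fun i : ℝ × ℝ => i.1) (η := fun i => i.2) (r := fun _ => 0)
      (w := fun i => m (0, i)) (C := C₀ * C * B) (q := fun ψ => C₀ / m 0 * q ψ) hp hm.measurable
      hsub (fun i => hm.pos _) (by fun_prop) (by simp [hq0]) ?_ ?_
    · intro i ψ
      have h1 := hqb i.1 i.2 0 ψ
      have h2 := hm2 (0, i) 0
      have h3 := norm_tfPlane_le (0, i)
      simp only [Prod.fst_zero, Prod.snd_zero, abs_zero, add_zero, one_mul, div_one] at h1 h2 h3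
      have hi := hm.pos (0, i)
      -- Decay of order N of the test distributions pays for the polynomial loss in comparing m(0)
      -- with m(0,i).
      have h4 : (1 + ‖((0 : ℝ × ℝ), i)‖) ^ N * ‖chirpDist i.1 i.2 0 g ψ‖ ≤ q ψ := by
        refine le_trans ?_ h1
        gcongr
      have h5 : m 0 * ‖chirpDist i.1 i.2 0 g ψ‖ ≤ C₀ * m (0, i) * q ψ := by
        calc m 0 * ‖chirpDist i.1 i.2 0 g ψ‖
            ≤ C₀ * (1 + ‖((0 : ℝ × ℝ), i)‖) ^ N * m (0, i) * ‖chirpDist i.1 i.2 0 g ψ‖ := by gcongr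
          _ = C₀ * m (0, i) * ((1 + ‖((0 : ℝ × ℝ), i)‖) ^ N * ‖chirpDist i.1 i.2 0 g ψ‖) := by ring
          _ ≤ _ := by gcongr
      rw [show m (0, i) * (C₀ / m 0 * q ψ) = C₀ * m (0, i) * q ψ / m 0 by ring, le_div_iff₀ hm0]
      linarith
    · intro i
      have hi := hm.pos (0, i)
      rw [eLpNorm_stft_chirpDist hm.measurable]
      refine (hmaj _ (C₀ * C * m (0, i)) 1 (by positivity) one_pos fun z => ?_).trans (le_of_eq ?_)
      · have h1 := hker 1 0 z.1 z.2 le_rfl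
          (by simp; linarith [abs_nonneg z.2.1]) (by simp)
        simp only [Real.sqrt_one, one_mul, div_one] at h1 ⊢
        have h2 := norm_tfPlane_le z
        rw [norm_mul, Complex.norm_real, Real.norm_of_nonneg (hm.pos _).le, neg_zero]
        calc ‖chirpKernel g γ 0 z.1 z.2‖ * m (z + (0, (i.1, i.2)))
            ≤ ‖chirpKernel g γ 0 z.1 z.2‖ * (C₀ * (1 + ‖z‖) ^ N * m (0, i)) := by
              gcongr; exact hm1 z (0, i)
          _ = C₀ * m (0, i) * ((1 + ‖z‖) ^ N * ‖chirpKernel g γ 0 z.1 z.2‖) := by ring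
          _ ≤ C₀ * m (0, i) * (((1 + |z.1.1|) * (1 + |z.1.2|) * ((1 + |z.2.1|) * (1 + |z.2.2|))) ^ N *
              ‖chirpKernel g γ 0 z.1 z.2‖) := by gcongr
          _ ≤ C₀ * m (0, i) * (C * majorant z) := by gcongr
          _ = _ := by ring
      · rw [Real.one_rpow]; congr 1; ring
  obtain ⟨c, hc, hev⟩ := eventually_le_eLpNorm_chirpKernel_growing hp hg
  refine ⟨κ * c / D, by positivity, ?_⟩
  filter_upwards [hev] with n hn η
  have h1 := hbound ((n : ℝ) + 1, η)
  rw [hcoeff] at h1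
  simp only [sub_zero] at h1
  have h2 := (mul_le_mul_right hn (ENNReal.ofReal κ)).trans h1
  have hpos := hm.pos (0, ((n : ℝ) + 1, η))
  rw [← ENNReal.ofReal_mul hκ.le, ENNReal.ofReal_le_ofReal_iff (by positivity)] at h2
  rw [div_mul_eq_mul_div, div_le_iff₀ hD]
  linarith

/-- For r = R the coorbit kernel has rate ω₁, free of R, so the coorbit norms stay bounded. The
modulation norms collect R^{α-1/2} from the weight and again from the spreading, and R^{2α-1} is
unbounded. -/
theorem coorbitSpace_ne_of_lt_two (hp : 1 ≤ p) (hp2 : 1 / 2 < (1 / p).toReal) (hlam : lam ≠ 0)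
    (hm : IsModerateWeight m) (hg : g ≠ 0) (hγ : γ ≠ 0) :
    G53.coorbitSpace lam p g ≠ modulationSpace p m γ := by
  intro heq
  obtain ⟨c, hc, hev⟩ := exists_weight_lower_bound hp hlam hm hg heq.ge
  obtain ⟨C₀, N, hC₀, hm1, hm2⟩ := hm.exists_two_sided
  obtain ⟨κ, hκ, hcoeff⟩ := exists_eLpNorm_coeff_chirpDist lam hlam p
  obtain ⟨B, hB, hmaj⟩ := exists_eLpNorm_le_of_majorant hp
  obtain ⟨C, hC, hker⟩ := exists_chirpKernel_le_majorant γ g 0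
  obtain ⟨q, hq, hq0, hqb⟩ := exists_chirpDist_bound γ 0
  obtain ⟨D, hD, hbound⟩ : ∃ D : ℝ, 0 < D ∧ ∀ n : ℕ,
      eLpNorm (fun z => stft γ (chirpDist ((n : ℝ) + 1) 0 ((n : ℝ) + 1) γ) z * (m z : ℂ)) p volume ≤
        ENNReal.ofReal (D * 1) := by
    refine exists_modulation_bound (R := fun n : ℕ => (n : ℝ) + 1) (η := fun _ => 0)
      (r := fun n => (n : ℝ) + 1) (w := fun _ => 1) (C := κ * (C * B)) (q := q) hp hm.measurable
      heq.le (fun _ => one_pos) hq hq0 ?_ ?_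
    · intro n ψ
      simpa using hqb ((n : ℝ) + 1) 0 ((n : ℝ) + 1) ψ
    · intro n
      rw [hcoeff, sub_self, mul_one, ENNReal.ofReal_mul hκ.le]
      gcongr
      refine (hmaj _ C 1 hC.le one_pos fun z => ?_).trans (by rw [Real.one_rpow, mul_one])
      have h1 := hker 1 z.2.1 z.1 z.2 le_rfl (by linarith [abs_nonneg z.2.1])
        (by nlinarith [abs_nonneg z.2.1])
      simpa using h1
  obtain ⟨c', hc', hev'⟩ := eventually_le_eLpNorm_chirpKernel_weighted hp hγ
    (continuous_weight_inv C₀ N hC₀) (fun z => by positivity)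
  have hgrow : ∀ᶠ n : ℕ in atTop, c * c' * ((n : ℝ) + 1) ^ (2 * ((1 / p).toReal - 1 / 2)) ≤ D := by
    filter_upwards [hev, hev'] with n h1 h2
    have hR : (0 : ℝ) < (n : ℝ) + 1 := by positivity
    have h3 := hbound n
    rw [eLpNorm_stft_chirpDist hm.measurable, mul_one] at h3
    have h4 : ENNReal.ofReal (c * ((n : ℝ) + 1) ^ ((1 / p).toReal - 1 / 2)) *
        eLpNorm (fun z : (ℝ × ℝ) × (ℝ × ℝ) => ‖chirpKernel γ γ (-((n : ℝ) + 1)) z.1 z.2‖ *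
          (C₀ * (1 + ‖(z.1, (z.2.1, (0 : ℝ)))‖) ^ N)⁻¹) p volume ≤
        eLpNorm (fun z => chirpKernel γ γ (-((n : ℝ) + 1)) z.1 z.2 *
          (m (z + (0, ((n : ℝ) + 1, 0))) : ℂ)) p volume := by
      have hcs := eLpNorm_const_smul (μ := (volume : Measure ((ℝ × ℝ) × (ℝ × ℝ))))
        (c * ((n : ℝ) + 1) ^ ((1 / p).toReal - 1 / 2))
        (fun z : (ℝ × ℝ) × (ℝ × ℝ) => ‖chirpKernel γ γ (-((n : ℝ) + 1)) z.1 z.2‖ *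
          (C₀ * (1 + ‖(z.1, (z.2.1, (0 : ℝ)))‖) ^ N)⁻¹) p
      rw [Real.enorm_of_nonneg (by positivity)] at hcs
      rw [← hcs]
      refine eLpNorm_mono fun z => ?_
      simp only [Pi.smul_apply, smul_eq_mul]
      rw [Real.norm_of_nonneg (by positivity), norm_mul, Complex.norm_real,
        Real.norm_of_nonneg (hm.pos _).le, mul_left_comm]
      gcongr
      -- The large coordinate ω₂ goes into the base point (R, ω₂), where the uniform bound applies
      -- with η = ω₂; moderateness is spent only on x and ω₁.
      rw [← div_eq_mul_inv, div_le_iff₀ (by positivity), tfPlane_split]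
      refine (h1 z.2.2).trans ((hm2 (z.1, (z.2.1, 0)) _).trans (le_of_eq (mul_comm _ _)))
    have h5 := ((mul_le_mul_right h2 _).trans h4).trans h3
    rw [← ENNReal.ofReal_mul (by positivity), ENNReal.ofReal_le_ofReal_iff hD.le] at h5
    refine le_trans (le_of_eq ?_) h5
    rw [two_mul, Real.rpow_add hR]
    ring
  have ht : Tendsto (fun n : ℕ => c * c' * ((n : ℝ) + 1) ^ (2 * ((1 / p).toReal - 1 / 2))) atTop
      atTop := by
    refine Tendsto.const_mul_atTop (by positivity) ?_
    exact (tendsto_rpow_atTop (by linarith)).comp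
      (tendsto_atTop_add_const_right _ _ tendsto_natCast_atTop_atTop)
  obtain ⟨n, h1, h2⟩ := (hgrow.and (ht.eventually_gt_atTop D)).exists
  linarith

/-- The same pure modulations with the opposite inclusion: the coorbit norm is at most of order
R^{α-1/2}, and moderateness bounds the modulation norm below by a multiple of m(0,(R,η)). The
envelope is now `γ`, so that the self-correlation is on the modulation side. -/
theorem exists_weight_upper_bound (hp : 1 ≤ p) (hlam : lam ≠ 0) (hm : IsModerateWeight m)
    (hγ : γ ≠ 0) (hsub : G53.coorbitSpace lam p g ⊆ modulationSpace p m γ) :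
    ∃ c : ℝ, 0 < c ∧ ∀ (n : ℕ) (η : ℝ),
      m (0, ((n : ℝ) + 1, η)) ≤ c * ((n : ℝ) + 1) ^ ((1 / p).toReal - 1 / 2) := by
  obtain ⟨C₀, N, hC₀, hm1, hm2⟩ := hm.exists_two_sided
  obtain ⟨κ, hκ, hcoeff⟩ := exists_eLpNorm_coeff_chirpDist lam hlam p
  obtain ⟨B, hB, hmaj⟩ := exists_eLpNorm_le_of_majorant hp
  obtain ⟨C, hC, hker⟩ := exists_chirpKernel_le_majorant γ g 0
  obtain ⟨q, hq, hq0, hqb⟩ := exists_chirpDist_bound γ 1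
  set α := (1 / p).toReal with hα
  have hα0 : 0 ≤ α := ENNReal.toReal_nonneg
  obtain ⟨D, hD, hbound⟩ : ∃ D : ℝ, 0 < D ∧ ∀ i : ℕ × ℝ,
      eLpNorm (fun z => stft γ (chirpDist ((i.1 : ℝ) + 1) i.2 0 γ) z * (m z : ℂ)) p volume ≤
        ENNReal.ofReal (D * ((i.1 : ℝ) + 1) ^ (α - 1 / 2)) := by
    refine exists_modulation_bound (R := fun i : ℕ × ℝ => (i.1 : ℝ) + 1) (η := fun i => i.2)
      (r := fun _ => 0) (w := fun i => ((i.1 : ℝ) + 1) ^ (α - 1 / 2)) (C := κ * (C * B)) (q := q) hp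
      hm.measurable hsub (fun i => by positivity) hq hq0 ?_ ?_
    · intro i ψ
      have hR : (1 : ℝ) ≤ (i.1 : ℝ) + 1 := by simp
      have h1 := hqb ((i.1 : ℝ) + 1) i.2 0 ψ
      rw [pow_one] at h1
      have h2 : ((i.1 : ℝ) + 1) * ‖chirpDist ((i.1 : ℝ) + 1) i.2 0 γ ψ‖ ≤ q ψ := by
        refine le_trans ?_ h1
        gcongr
        rw [abs_of_pos (by linarith)]
        have : 0 ≤ |i.2| / (1 + |(0 : ℝ)|) := by positivity
        nlinarith
      have hq1 : 0 ≤ q ψ := le_trans (by positivity) h2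
      -- Since α ≥ 0, the weight is at least R⁻¹, so one order of decay in R gives equicontinuity.
      have h3 : ((i.1 : ℝ) + 1) ^ (-1 : ℝ) ≤ ((i.1 : ℝ) + 1) ^ (α - 1 / 2) :=
        Real.rpow_le_rpow_of_exponent_le hR (by linarith)
      rw [Real.rpow_neg_one] at h3
      calc ‖chirpDist ((i.1 : ℝ) + 1) i.2 0 γ ψ‖ ≤ ((i.1 : ℝ) + 1)⁻¹ * q ψ := by
            rw [le_inv_mul_iff₀ (by linarith)]; exact h2
        _ ≤ _ := by gcongr
    · intro i
      have hR : (1 : ℝ) ≤ (i.1 : ℝ) + 1 := by simp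
      have hR0 : (0 : ℝ) < (i.1 : ℝ) + 1 := by linarith
      have hs : 0 < √((i.1 : ℝ) + 1) := Real.sqrt_pos.2 hR0
      rw [hcoeff, sub_zero, mul_assoc, ENNReal.ofReal_mul hκ.le]
      gcongr
      refine (hmaj _ (C / √((i.1 : ℝ) + 1)) ((i.1 : ℝ) + 1) (by positivity) hR0 fun z => ?_).trans
        (le_of_eq ?_)
      · have e1 : |z.2.1 + ((i.1 : ℝ) + 1)| ≤ |z.2.1| + ((i.1 : ℝ) + 1) :=
          (abs_add_le _ _).trans (by rw [abs_of_pos hR0])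
        have e2 : (i.1 : ℝ) + 1 ≤ |z.2.1 + ((i.1 : ℝ) + 1)| + |z.2.1| := by
          have := le_abs_self (z.2.1 + ((i.1 : ℝ) + 1))
          have := neg_abs_le z.2.1
          linarith
        have e3 := mul_nonneg (abs_nonneg (z.2.1 + ((i.1 : ℝ) + 1))) (abs_nonneg z.2.1)
        have h1 := hker ((i.1 : ℝ) + 1) (z.2.1 + ((i.1 : ℝ) + 1)) z.1 z.2 hR
          (by nlinarith [abs_nonneg z.2.1]) (by nlinarith)
        rw [pow_zero, one_mul] at h1
        rw [div_mul_eq_mul_div, le_div_iff₀ hs]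
        linarith
      · rw [Real.rpow_sub hR0, ← Real.sqrt_eq_rpow]
        congr 1
        ring
  have hl : Continuous fun z : (ℝ × ℝ) × (ℝ × ℝ) =>
      ‖chirpKernel γ γ 0 z.1 z.2‖ * (C₀ * (1 + ‖z‖) ^ N)⁻¹ :=
    (Continuous.chirpKernel γ γ (by fun_prop) (by fun_prop) (by fun_prop)).norm.mul
      (continuous_weight_inv C₀ N hC₀)
  obtain ⟨c, hc, hlow⟩ := exists_le_eLpNorm_of_continuous hp hl (z₀ := 0) (by
    have := norm_ne_zero_iff.2 (chirpKernel_self_ne_zero hγ)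
    simp only [Prod.fst_zero, Prod.snd_zero]
    positivity)
  refine ⟨D / c, by positivity, fun n η => ?_⟩
  have hw := hm.pos (0, ((n : ℝ) + 1, η))
  have h3 := hbound (n, η)
  rw [eLpNorm_stft_chirpDist hm.measurable] at h3
  have h4 : ENNReal.ofReal (m (0, ((n : ℝ) + 1, η))) *
      eLpNorm (fun z : (ℝ × ℝ) × (ℝ × ℝ) =>
        ‖chirpKernel γ γ 0 z.1 z.2‖ * (C₀ * (1 + ‖z‖) ^ N)⁻¹) p volume ≤
      eLpNorm (fun z => chirpKernel γ γ (-0) z.1 z.2 *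
        (m (z + (0, ((n : ℝ) + 1, η))) : ℂ)) p volume := by
    have hcs := eLpNorm_const_smul (μ := (volume : Measure ((ℝ × ℝ) × (ℝ × ℝ))))
      (m (0, ((n : ℝ) + 1, η)))
      (fun z : (ℝ × ℝ) × (ℝ × ℝ) => ‖chirpKernel γ γ 0 z.1 z.2‖ * (C₀ * (1 + ‖z‖) ^ N)⁻¹) p
    rw [Real.enorm_of_nonneg hw.le] at hcs
    rw [← hcs]
    refine eLpNorm_mono fun z => ?_
    simp only [Pi.smul_apply, smul_eq_mul]
    rw [Real.norm_of_nonneg (by positivity), norm_mul, Complex.norm_real,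
      Real.norm_of_nonneg (hm.pos _).le, mul_left_comm, neg_zero]
    gcongr
    rw [← div_eq_mul_inv, div_le_iff₀ (by positivity)]
    exact (hm2 z _).trans (le_of_eq (mul_comm _ _))
  have h5 := ((mul_le_mul_right hlow _).trans h4).trans h3
  rw [← ENNReal.ofReal_mul hw.le, ENNReal.ofReal_le_ofReal_iff (by positivity)] at h5
  rw [div_mul_eq_mul_div, le_div_iff₀ hc]
  exact h5

/-- On the chirps with r = R the modulation norm is at most of order R^{2α-1}, which tends to 0,
while the coorbit norm is the constant `κ` times that of a fixed nonzero kernel of rate ω₁. -/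
theorem coorbitSpace_ne_of_two_lt (hp : 1 ≤ p) (hp2 : (1 / p).toReal < 1 / 2) (hlam : lam ≠ 0)
    (hm : IsModerateWeight m) (hg : g ≠ 0) (hγ : γ ≠ 0) :
    G53.coorbitSpace lam p g ≠ modulationSpace p m γ := by
  intro heq
  obtain ⟨c, hc, hup⟩ := exists_weight_upper_bound hp hlam hm hγ heq.le
  obtain ⟨C₀, N, hC₀, hm1, hm2⟩ := hm.exists_two_sided
  obtain ⟨κ, hκ, hcoeff⟩ := exists_eLpNorm_coeff_chirpDist lam hlam p
  obtain ⟨B, hB, hmaj⟩ := exists_eLpNorm_le_of_majorant hp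
  obtain ⟨C, hC, hker⟩ := exists_chirpKernel_le_majorant g γ N
  obtain ⟨q, hq, hq0, hqb⟩ := exists_chirpDist_bound g 1
  set α := (1 / p).toReal with hα
  have hα0 : 0 ≤ α := ENNReal.toReal_nonneg
  obtain ⟨D, hD, hbound⟩ : ∃ D : ℝ, 0 < D ∧ ∀ n : ℕ,
      eLpNorm (fun X => G53.coeff lam g (chirpDist ((n : ℝ) + 1) 0 ((n : ℝ) + 1) g)
        (G53.ofQuot X)) p volume ≤ ENNReal.ofReal (D * ((n : ℝ) + 1) ^ (2 * (α - 1 / 2))) := by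
    refine exists_coorbit_bound (R := fun n : ℕ => (n : ℝ) + 1) (η := fun _ => 0)
      (r := fun n => (n : ℝ) + 1) (w := fun n => ((n : ℝ) + 1) ^ (2 * (α - 1 / 2)))
      (C := C₀ * c * C * B) (q := q) hp hm.measurable heq.ge (fun n => by positivity) hq hq0 ?_ ?_
    · intro n ψ
      have hR : (1 : ℝ) ≤ (n : ℝ) + 1 := by simp
      have h1 := hqb ((n : ℝ) + 1) 0 ((n : ℝ) + 1) ψ
      rw [pow_one, abs_zero, zero_div, add_zero, mul_one] at h1
      have h2 : ((n : ℝ) + 1) * ‖chirpDist ((n : ℝ) + 1) 0 ((n : ℝ) + 1) g ψ‖ ≤ q ψ := by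
        refine le_trans (mul_le_mul_of_nonneg_right ?_ (norm_nonneg _)) h1
        rw [abs_of_pos (by linarith)]
        linarith
      have hq1 : 0 ≤ q ψ := le_trans (by positivity) h2
      -- The exponent 2α - 1 is at least -1, with equality at p = ∞, so a single order of decay in R
      -- is just enough.
      have h3 : ((n : ℝ) + 1) ^ (-1 : ℝ) ≤ ((n : ℝ) + 1) ^ (2 * (α - 1 / 2)) :=
        Real.rpow_le_rpow_of_exponent_le hR (by linarith)
      rw [Real.rpow_neg_one] at h3
      calc ‖chirpDist ((n : ℝ) + 1) 0 ((n : ℝ) + 1) g ψ‖ ≤ ((n : ℝ) + 1)⁻¹ * q ψ := by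
            rw [le_inv_mul_iff₀ (by linarith)]; exact h2
        _ ≤ _ := by gcongr
    · intro n
      have hR : (1 : ℝ) ≤ (n : ℝ) + 1 := by simp
      have hR0 : (0 : ℝ) < (n : ℝ) + 1 := by linarith
      have hs : 0 < √((n : ℝ) + 1) := Real.sqrt_pos.2 hR0
      rw [eLpNorm_stft_chirpDist hm.measurable]
      refine (hmaj _ (C₀ * (c * ((n : ℝ) + 1) ^ (α - 1 / 2)) * (C / √((n : ℝ) + 1))) ((n : ℝ) + 1)
        (by positivity) hR0 fun z => ?_).trans (le_of_eq ?_)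
      · have h1 := hker ((n : ℝ) + 1) (-((n : ℝ) + 1)) z.1 z.2 hR
          (by rw [abs_neg, abs_of_pos hR0]; nlinarith [abs_nonneg z.2.1])
          (by rw [abs_neg, abs_of_pos hR0]; nlinarith [abs_nonneg z.2.1])
        -- The moderateness factor involves only x and ω₁, so the kernel decay absorbs it even
        -- though ω₂ is controlled only at scale R.
        have h2 : (1 + ‖(z.1, (z.2.1, (0 : ℝ)))‖) ≤
            (1 + |z.1.1|) * (1 + |z.1.2|) * ((1 + |z.2.1|) * (1 + |z.2.2| / ((n : ℝ) + 1))) := by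
          refine (norm_tfPlane_le _).trans ?_
          have : 0 ≤ |z.2.2| / ((n : ℝ) + 1) := by positivity
          simp only [abs_zero, add_zero, mul_one]
          gcongr
          exact le_mul_of_one_le_right (by positivity) (by linarith)
        set K := ‖chirpKernel g γ (-((n : ℝ) + 1)) z.1 z.2‖ with hK
        have h3 : (1 + ‖(z.1, (z.2.1, (0 : ℝ)))‖) ^ N * K ≤
            C / √((n : ℝ) + 1) * majorant (z.1, (z.2.1, z.2.2 / ((n : ℝ) + 1))) := by
          rw [div_mul_eq_mul_div, le_div_iff₀ hs]
          refine le_trans ?_ h1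
          rw [mul_comm]
          gcongr
        rw [norm_mul, Complex.norm_real, Real.norm_of_nonneg (hm.pos _).le, tfPlane_split]
        calc K * m ((z.1, (z.2.1, (0 : ℝ))) + (0, ((n : ℝ) + 1, z.2.2)))
            ≤ K * (C₀ * (1 + ‖(z.1, (z.2.1, (0 : ℝ)))‖) ^ N *
                (c * ((n : ℝ) + 1) ^ (α - 1 / 2))) := by
              gcongr
              refine (hm1 _ _).trans ?_
              gcongr
              exact hup n z.2.2
          _ = C₀ * (c * ((n : ℝ) + 1) ^ (α - 1 / 2)) *
                ((1 + ‖(z.1, (z.2.1, (0 : ℝ)))‖) ^ N * K) := by ring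
          _ ≤ C₀ * (c * ((n : ℝ) + 1) ^ (α - 1 / 2)) * (C / √((n : ℝ) + 1) *
                majorant (z.1, (z.2.1, z.2.2 / ((n : ℝ) + 1)))) := by gcongr
          _ = _ := by ring
      · rw [two_mul, Real.rpow_add hR0]
        have e : ((n : ℝ) + 1) ^ (α - 1 / 2) = ((n : ℝ) + 1) ^ α / √((n : ℝ) + 1) := by
          rw [Real.rpow_sub hR0, ← Real.sqrt_eq_rpow]
        congr 1
        rw [e]
        ring
  have hl : Continuous fun z : (ℝ × ℝ) × (ℝ × ℝ) => ‖chirpKernel g g z.2.1 z.1 z.2‖ :=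
    (Continuous.chirpKernel g g (by fun_prop) (by fun_prop) (by fun_prop)).norm
  obtain ⟨c', hc', hlow⟩ := exists_le_eLpNorm_of_continuous hp hl (z₀ := 0)
    (norm_ne_zero_iff.2 (chirpKernel_self_ne_zero hg))
  rw [eLpNorm_norm] at hlow
  have hdecay : ∀ n : ℕ, κ * c' ≤ D * ((n : ℝ) + 1) ^ (2 * (α - 1 / 2)) := by
    intro n
    have h1 := hbound n
    rw [hcoeff, sub_self] at h1
    simp only [add_zero] at h1
    have h2 := (mul_le_mul_right hlow (ENNReal.ofReal κ)).trans h1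
    rwa [← ENNReal.ofReal_mul hκ.le, ENNReal.ofReal_le_ofReal_iff (by positivity)] at h2
  have ht : Tendsto (fun n : ℕ => D * ((n : ℝ) + 1) ^ (2 * (α - 1 / 2))) atTop (𝓝 (D * 0)) := by
    refine Tendsto.const_mul _ ?_
    have h := (tendsto_rpow_neg_atTop (y := -(2 * (α - 1 / 2))) (by linarith)).comp
      (tendsto_atTop_add_const_right atTop (1 : ℝ) (tendsto_natCast_atTop_atTop (R := ℝ)))
    simpa only [neg_neg, Function.comp_def] using h
  have := ge_of_tendsto' ht hdecay
  have : 0 < κ * c' := by positivity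
  linarith

end Ranges

end

theorem mainTheorem1 (p : ℝ≥0∞) (hp1 : 1 ≤ p) (hp2 : p ≠ 2) (lam : ℝ) (hlam : lam ≠ 0)
    (m : (ℝ × ℝ) × (ℝ × ℝ) → ℝ) (hm : IsModerateWeight m)
    (g γ : 𝓢(ℝ × ℝ, ℂ)) (hg : g ≠ 0) (hγ : γ ≠ 0) :
    G53.coorbitSpace lam p g ≠ modulationSpace p m γ := by
  have hp0 : p ≠ 0 := by rintro rfl; simp at hp1
  have h2 : ((2 : ℝ≥0∞)⁻¹).toReal = 1 / 2 := by simp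
  have hfin : p⁻¹ ≠ ∞ := ENNReal.inv_ne_top.2 hp0
  rcases lt_or_gt_of_ne hp2 with h | h
  · refine coorbitSpace_ne_of_lt_two hp1 ?_ hlam hm hg hγ
    rw [one_div p, ← h2]
    exact ENNReal.toReal_strict_mono hfin (ENNReal.inv_lt_inv.2 h)
  · refine coorbitSpace_ne_of_two_lt hp1 ?_ hlam hm hg hγ
    rw [one_div p, ← h2]
    exact ENNReal.toReal_strict_mono (by simp) (ENNReal.inv_lt_inv.2 h)
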